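/- Theorem 3.1. Let $p>1$, $\varphi(t)=t|t|^{p-2}$, and for $\lambda>0$ consider $$\varphi(u'(x))'+\lambda f(u(x))=0\quad(-1<x<1),\qquad u(-1)=u(1)=0, \tag{1}$$ where $f\in C^1[0,\infty)$. Assume that for some $\gamma>0$: $f<0$ on $(0,\gamma)$, $f>0$ on $(\gamma,\infty)$, and $f'(u)-(p-1)\frac{f(u)}{u}>0$ for $u>\gamma$; that for some $q>p-1$ the limit $\lim_{u\to\infty}f(u)/u^q$ exists in $[-\infty,\infty]$ and is positive (possibly $+\infty$); and, in case $f(0)=0$, that there is $c_0>0$ with $-f(s)<c_0s^{p-1}$ for all small $s>0$. A positive solution is a function $u\in C^1[-1,1]$, $u>0$ on $(-1,1)$, with $\varphi(u')$ differentiable on $(-1,1)$, that satisfies (1). The linearized problem at $u$ is $$(\varphi'(u')w')'+\lambda f'(u)w=0\quad\text{on }(-1,1),\qquad w(-1)=w(1)=0, \tag{2}$$ where $w\in C[-1,1]$ is differentiable at the points of $(-1,1)$ with $u'\ne0$, and the flux $\varphi'(u')w'$, extended by continuity to the points where $u'=0$, is differentiable on $(-1,1)$. Call $u$ non-degenerate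 if (2) has only the solution $w=0$, and non-degenerate among even functions if (2) has only the even solution $w=0$. Then: 1. For each $\lambda>0$, (1) has at most one positive solution, and for all sufficiently small $\lambda>0$ it has exactly one. 2. Every positive solution of (1) is non-degenerate among even functions, and every positive solution with $u'(1)\neq0$ is non-degenerate. 3. If $f(0)<0$, there is $\lambda_0\in(0,\infty)$ such that (1) has a positive solution $u(\cdot,\lambda)$ if and only if $0<\lambda\le\lambda_0$. These solutions form a single curve without turns: $\lambda\mapsto u(\cdot,\lambda)$ is continuous from $(0,\lambda_0]$ to $C^1[-1,1]$. They are non-degenerate for $0<\lambda<\lambda_0$, $u(0,\lambda)\to\infty$ as $\lambda\to0^+$, and $u'(\pm1,\lambda_0)=0$. 4. If $f(0)=0$, then (1) has a positive solution $u(\cdot,\lambda)$ for every $\lambda>0$. These solutions form a single curve without turns: $\lambda\mapsto u(\cdot,\lambda)$ is continuous from $(0,\infty)$ to $C^1[-1,1]$. They are all non-degenerate, $u(0,\lambda)\to\infty$ as $\lambda\to0^+$, and $u(x,\lambda)\to0$ as $\lambda\to\infty$ for every $x\in[-1,1]$, $x\ne0$. -/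

import Mathlib

open Set Filter Topology

namespace PLap

/-- `φ(t) = t |t|^(p-2)`; for `p > 1` this is continuous and `φ(0) = 0`. -/
noncomputable def phi (p t : ℝ) : ℝ := t * |t| ^ (p - 2)

/-- The derivative of a function on `[-1,1]`, one-sided at the end points. -/
noncomputable def D (u : ℝ → ℝ) (x : ℝ) : ℝ := derivWithin u (Icc (-1) 1) x

/-- Classical positive solutions of `φ(u')' + lam f(u) = 0` on `(-1,1)`, `u(-1) = u(1) = 0`:
`u ∈ C¹[-1,1]`, `φ(u')` is differentiable on `(-1,1)`, and `u > 0` on `(-1,1)`. Only the values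
of `u` on `[-1,1]` matter. -/
structure IsPositiveSolution (p : ℝ) (f : ℝ → ℝ) (lam : ℝ) (u : ℝ → ℝ) : Prop where
  contDiffOn : ContDiffOn ℝ 1 u (Icc (-1) 1)
  equation : ∀ x ∈ Ioo (-1 : ℝ) 1,
    HasDerivAt (fun y => phi p (D u y)) (-(lam * f (u x))) x
  left : u (-1) = 0
  right : u 1 = 0
  pos : ∀ x ∈ Ioo (-1 : ℝ) 1, 0 < u x

/-- Solutions `w` of the linearized problem `(φ'(u') w')' + lam f'(u) w = 0` on `(-1,1)`,
`w(-1) = w(1) = 0`. For `p ≠ 2` the coefficient `φ'(u')` vanishes or blows up where `u' = 0`;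
there the flux `v = φ'(u') w'` is understood by continuity, as is customary. So `w` is continuous
on `[-1,1]`, is differentiable where `u' ≠ 0`, and its flux there extends to a function `v` on
`(-1,1)` with `v' = -lam f'(u) w`. -/
structure IsLinearizedSolution (p : ℝ) (f : ℝ → ℝ) (lam : ℝ) (u w : ℝ → ℝ) : Prop where
  continuousOn : ContinuousOn w (Icc (-1) 1)
  left : w (-1) = 0
  right : w 1 = 0
  equation : ∃ v : ℝ → ℝ,
    (∀ x ∈ Ioo (-1 : ℝ) 1, D u x ≠ 0 →
      DifferentiableAt ℝ w x ∧ v x = deriv (phi p) (D u x) * deriv w x) ∧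
    ∀ x ∈ Ioo (-1 : ℝ) 1, HasDerivAt v (-(lam * deriv f (u x) * w x)) x

/-- The linearized problem at `u` has only the trivial solution. -/
def Nondegenerate (p : ℝ) (f : ℝ → ℝ) (lam : ℝ) (u : ℝ → ℝ) : Prop :=
  ∀ w, IsLinearizedSolution p f lam u w → ∀ x ∈ Icc (-1 : ℝ) 1, w x = 0

/-- The linearized problem at `u` has only the trivial solution among even functions. -/
def NondegenerateEven (p : ℝ) (f : ℝ → ℝ) (lam : ℝ) (u : ℝ → ℝ) : Prop :=
  ∀ w, IsLinearizedSolution p f lam u w → (∀ x ∈ Icc (-1 : ℝ) 1, w (-x) = w x) →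
    ∀ x ∈ Icc (-1 : ℝ) 1, w x = 0

/-- `lam ↦ U lam`, `lam ∈ Λ`, is a curve without turns (a continuous graph over the parameter set
`Λ`, with values in `C¹[-1,1]`) of positive solutions, and it contains all positive solutions for
all positive values of the parameter. -/
structure IsSolutionCurve (p : ℝ) (f : ℝ → ℝ) (Λ : Set ℝ) (U : ℝ → ℝ → ℝ) : Prop where
  solution : ∀ lam ∈ Λ, IsPositiveSolution p f lam (U lam)
  all : ∀ lam, 0 < lam → ∀ u, IsPositiveSolution p f lam u →
    lam ∈ Λ ∧ EqOn u (U lam) (Icc (-1) 1)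
  continuous : ∀ lam ∈ Λ, TendstoUniformlyOn U (U lam) (𝓝[Λ] lam) (Icc (-1) 1)
  continuous_deriv : ∀ lam ∈ Λ,
    TendstoUniformlyOn (fun m => D (U m)) (D (U lam)) (𝓝[Λ] lam) (Icc (-1) 1)

end PLap

/-!
The equation conserves the energy `(p-1)/p |u'|^p + lam F(u)`, where `F(s) = ∫₀ˢ f`. Hence a
positive solution has a single critical point, its maximum `M`, and away from it
`|u'| = (p/(p-1) lam (F(M) - F(u)))^(1/p)`. The substitution `t = u(x)/M` turns this into
`∫_{u(x)/M}^1 ker(M, t) dt = (p/(p-1) lam)^(1/p) |x|` with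
`ker(M, t) = ((F(M) - F(Mt)) / M^p)^(-1/p)` (`IsPositiveSolution.tail_eq`), so that `u` is even, is
determined by `M`, and `M` is tied to `lam` by the time map `∫₀¹ ker(M, t) dt`. Conversely,
inverting the partial time map produces a solution for each `M` at which the time map converges
(`Admissible.exists_solution`).

All statements about the solution curve rest on one monotonicity: the `M`-derivative of
`(F(M) - F(Mt)) / M^p` is `(H(M) - H(Mt)) / M^(p+1)` with `H(s) = s f(s) - p F(s)`, and `H` exceeds
its earlier values beyond `γ` (`Admissible.hump_lt`): beyond `γ` it increases because
`f(u)/u^(p-1)` does, and below `γ` it is at most `H(γ)` because `f < 0` there. So the integrand of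
the time map decreases with `M`. This gives uniqueness, and it provides the dominating functions
for the continuity of the curve in `C¹` and for the decay of the time map as `M → ∞`. The time map
is defined for `M` above the positive zero `θ` of `F`; at `θ` it converges if `f(0) < 0`, where the
curve ends with `u'(±1) = 0`, and it diverges if `f(0) = 0`, where the curve continues for all
values of the parameter.

Non-degeneracy is the differential counterpart. For a linearized solution `w` put
`y = w - (w(0)/M) u`. The Wronskian of `y` and `u'` equals `(w(0)/M) lam (H(M) - H(u))`
(`IsLinearizedPair.wronskian`). If `u'(1) = 0`, letting `x → 1` gives `w(0) = 0`. If `u'(1) ≠ 0` and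
`w(0) > 0`, then `y/u'` is increasing, which is incompatible with `y(1) = 0` and the sign of `y`
near the origin (`IsLinearizedPair.false_of_pos`). So `w(0) = 0`; then `w` is a multiple of `u'` on
each half of the interval, and it vanishes if `u'(1) ≠ 0` or if `w` is even.
-/

open Set Filter Topology

namespace PLap

open MeasureTheory

/-! ### The nonlinearity and its primitive -/

/-- The hypotheses on the nonlinearity: `f` is negative on `(0, γ)` and positive beyond `γ`,
`f(u) / u^(p-1)` is increasing beyond `γ`, and `f` grows at least like `u^q` with `q > p - 1`. -/
structure Admissible (p q γ : ℝ) (f : ℝ → ℝ) : Prop where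
  one_lt : 1 < p
  pos_gamma : 0 < γ
  contDiffOn : ContDiffOn ℝ 1 f (Ici 0)
  neg : ∀ u ∈ Ioo 0 γ, f u < 0
  pos : ∀ u, γ < u → 0 < f u
  incr : ∀ u, γ < u → 0 < deriv f u - (p - 1) * (f u / u)
  lt_q : p - 1 < q
  growth : ∃ c > 0, ∃ S > 0, ∀ s, S ≤ s → c * s ^ q ≤ f s

/-- The primitive `F(s) = ∫₀ˢ f`. The integrand is frozen at `f 0` for negative arguments, where
`f` is unconstrained, so that `F` is of class `C¹` on the whole line. -/
noncomputable def prim (f : ℝ → ℝ) (s : ℝ) : ℝ := ∫ r in (0 : ℝ)..s, f (max r 0)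

/-- `H(s) = s f(s) - p F(s)`, whose increments are the `M`-derivative of the potential drop; its
derivative is `s f'(s) - (p - 1) f(s)`. -/
noncomputable def hump (p : ℝ) (f : ℝ → ℝ) (s : ℝ) : ℝ := s * f s - p * prim f s

lemma prim_zero (f : ℝ → ℝ) : prim f 0 = 0 := by simp [prim]

namespace Admissible

variable {p q γ : ℝ} {f : ℝ → ℝ}

lemma continuous_trunc (h : Admissible p q γ f) : Continuous fun r => f (max r 0) :=
  h.contDiffOn.continuousOn.comp_continuous (by fun_prop) fun r => le_max_right r 0

lemma hasDerivAt_prim' (h : Admissible p q γ f) (s : ℝ) :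
    HasDerivAt (prim f) (f (max s 0)) s :=
  (h.continuous_trunc.integral_hasStrictDerivAt 0 s).hasDerivAt

lemma hasDerivAt_prim (h : Admissible p q γ f) {s : ℝ} (hs : 0 ≤ s) :
    HasDerivAt (prim f) (f s) s := by
  simpa [max_eq_left hs] using h.hasDerivAt_prim' s

lemma continuous_prim (h : Admissible p q γ f) : Continuous (prim f) :=
  continuous_iff_continuousAt.2 fun s => (h.hasDerivAt_prim' s).continuousAt

lemma hasDerivAt (h : Admissible p q γ f) {s : ℝ} (hs : 0 < s) :
    HasDerivAt f (deriv f s) s :=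
  (((h.contDiffOn.differentiableOn one_ne_zero) s hs.le).differentiableAt
    (Ici_mem_nhds hs)).hasDerivAt

lemma continuousOn_deriv (h : Admissible p q γ f) : ContinuousOn (deriv f) (Ioi 0) :=
  (h.contDiffOn.mono Ioi_subset_Ici_self).continuousOn_deriv_of_isOpen isOpen_Ioi le_rfl

/-- `f'` stays bounded down to `0`, because `f` is of class `C¹` up to the end point. -/
lemma exists_deriv_bound (h : Admissible p q γ f) (M : ℝ) :
    ∃ C, ∀ s ∈ Ioc 0 M, |deriv f s| ≤ C := by
  have h1 : ContinuousOn (derivWithin f (Ici 0)) (Icc 0 M) :=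
    (h.contDiffOn.continuousOn_derivWithin (uniqueDiffOn_Ici 0) le_rfl).mono Icc_subset_Ici_self
  obtain ⟨C, hC⟩ := isCompact_Icc.exists_bound_of_continuousOn h1
  refine ⟨C, fun s hs => ?_⟩
  rw [← derivWithin_of_mem_nhds (Ici_mem_nhds hs.1)]
  exact hC s ⟨hs.1.le, hs.2⟩

lemma apply_gamma (h : Admissible p q γ f) : f γ = 0 := by
  have hc : ContinuousAt f γ := (h.hasDerivAt h.pos_gamma).continuousAt
  apply le_antisymm
  · refine le_of_tendsto (hc.tendsto.mono_left nhdsWithin_le_nhds : Tendsto f (𝓝[<] γ) _) ?_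
    filter_upwards [Ioo_mem_nhdsLT h.pos_gamma] with s hs using (h.neg s hs).le
  · refine ge_of_tendsto (hc.tendsto.mono_left nhdsWithin_le_nhds : Tendsto f (𝓝[>] γ) _) ?_
    filter_upwards [self_mem_nhdsWithin] with s hs using (h.pos s hs).le

lemma strictAntiOn_prim (h : Admissible p q γ f) : StrictAntiOn (prim f) (Icc 0 γ) := by
  refine strictAntiOn_of_deriv_neg (convex_Icc 0 γ) h.continuous_prim.continuousOn fun s hs => ?_
  rw [interior_Icc] at hs
  rw [(h.hasDerivAt_prim hs.1.le).deriv]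
  exact h.neg s hs

lemma strictMonoOn_prim (h : Admissible p q γ f) : StrictMonoOn (prim f) (Ici γ) := by
  refine strictMonoOn_of_deriv_pos (convex_Ici γ) h.continuous_prim.continuousOn fun s hs => ?_
  rw [interior_Ici] at hs
  rw [(h.hasDerivAt_prim (h.pos_gamma.trans hs).le).deriv]
  exact h.pos s hs

lemma prim_neg (h : Admissible p q γ f) {s : ℝ} (hs : s ∈ Ioc 0 γ) : prim f s < 0 := by
  have := h.strictAntiOn_prim ⟨le_rfl, h.pos_gamma.le⟩ ⟨hs.1.le, hs.2⟩ hs.1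
  rwa [prim_zero] at this

lemma gamma_lt (h : Admissible p q γ f) {M : ℝ} (hM : 0 < M) (hF : 0 ≤ prim f M) : γ < M := by
  by_contra! hle
  exact absurd (h.prim_neg ⟨hM, hle⟩) hF.not_gt

lemma prim_lt (h : Admissible p q γ f) {s M : ℝ} (hF : 0 ≤ prim f M) (hs : 0 < s) (hsM : s < M) :
    prim f s < prim f M := by
  rcases le_or_gt s γ with hle | hlt
  · exact (h.prim_neg ⟨hs, hle⟩).trans_le hF
  · exact h.strictMonoOn_prim hlt.le (hlt.trans hsM).le hsM

lemma hasDerivAt_hump (h : Admissible p q γ f) {s : ℝ} (hs : 0 < s) :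
    HasDerivAt (hump p f) (s * deriv f s - (p - 1) * f s) s := by
  have := ((hasDerivAt_id s).mul (h.hasDerivAt hs)).sub ((h.hasDerivAt_prim hs.le).const_mul p)
  refine this.congr_deriv ?_
  simp only [id]
  ring

lemma continuousOn_hump (h : Admissible p q γ f) : ContinuousOn (hump p f) (Ici 0) :=
  (continuousOn_id.mul h.contDiffOn.continuousOn).sub
    (continuousOn_const.mul h.continuous_prim.continuousOn)

/-- The function `H` exceeds all its earlier values beyond `γ`, although its monotonicity on
`(0, γ)` is not known: there `f < 0` gives `H ≤ -p F ≤ -p F(γ) = H(γ)`. -/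
lemma hump_lt (h : Admissible p q γ f) {s M : ℝ} (hs : 0 ≤ s) (hsM : s < M) (hM : γ < M) :
    hump p f s < hump p f M := by
  have hmono : StrictMonoOn (hump p f) (Ici γ) := by
    refine strictMonoOn_of_deriv_pos (convex_Ici γ)
      (h.continuousOn_hump.mono (Ici_subset_Ici.2 h.pos_gamma.le)) fun s hs => ?_
    rw [interior_Ici] at hs
    have hs0 : 0 < s := h.pos_gamma.trans hs
    rw [(h.hasDerivAt_hump hs0).deriv]
    have h1 := mul_pos hs0 (h.incr s hs)
    have h2 : s * (deriv f s - (p - 1) * (f s / s)) = s * deriv f s - (p - 1) * f s := by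
      field_simp
    linarith
  rcases le_or_gt s γ with hle | hlt
  · refine lt_of_le_of_lt ?_ (hmono self_mem_Ici hM.le hM)
    have h1 : s * f s ≤ 0 := by
      rcases hs.eq_or_lt with rfl | hs
      · simp
      · rcases hle.eq_or_lt with rfl | hlt
        · simp [h.apply_gamma]
        · exact mul_nonpos_of_nonneg_of_nonpos hs.le (h.neg s ⟨hs, hlt⟩).le
    have h2 : prim f γ ≤ prim f s :=
      h.strictAntiOn_prim.antitoneOn ⟨hs, hle⟩ ⟨h.pos_gamma.le, le_rfl⟩ hle
    have h3 := mul_le_mul_of_nonneg_left h2 (by linarith [h.one_lt] : 0 ≤ p)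
    simp only [hump, h.apply_gamma]
    linarith
  · exact hmono hlt.le (hlt.trans hsM).le hsM

/-- Integrated form of the growth condition. -/
lemma exists_prim_growth (h : Admissible p q γ f) : ∃ c > 0, ∃ S > 0, ∀ a b, S ≤ a → a ≤ b →
    c * (b ^ (q + 1) - a ^ (q + 1)) ≤ prim f b - prim f a := by
  obtain ⟨c, hc, S, hS, hf⟩ := h.growth
  have hq : 0 < q + 1 := by linarith [h.one_lt, h.lt_q]
  refine ⟨c / (q + 1), by positivity, S, hS, fun a b ha hab => ?_⟩
  have hmono : MonotoneOn (fun s => prim f s - c / (q + 1) * s ^ (q + 1)) (Ici S) := by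
    have hd : ∀ s, S ≤ s → HasDerivAt (fun s => prim f s - c / (q + 1) * s ^ (q + 1))
        (f s - c / (q + 1) * ((q + 1) * s ^ (q + 1 - 1))) s := fun s hs =>
      (h.hasDerivAt_prim (hS.le.trans hs)).sub
        ((Real.hasDerivAt_rpow_const (Or.inl (hS.trans_le hs).ne')).const_mul _)
    refine monotoneOn_of_deriv_nonneg (convex_Ici S)
      (fun s hs => (hd s hs).continuousAt.continuousWithinAt)
      (fun s hs => ((hd s (interior_subset hs)).differentiableAt).differentiableWithinAt)
      fun s hs => ?_
    have hs' : S ≤ s := interior_subset hs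
    rw [(hd s hs').deriv]
    have h1 := hf s hs'
    have h2 : c / (q + 1) * ((q + 1) * s ^ (q + 1 - 1)) = c * s ^ q := by
      rw [add_sub_cancel_right]; field_simp
    linarith
  have := hmono ha (ha.trans hab) hab
  simp only at this
  linarith

lemma tendsto_prim (h : Admissible p q γ f) : Tendsto (prim f) atTop atTop := by
  obtain ⟨c, hc, S, hS, hF⟩ := h.exists_prim_growth
  have hq : 0 < q + 1 := by linarith [h.one_lt, h.lt_q]
  have h1 : Tendsto (fun b : ℝ => c * b ^ (q + 1) + (prim f S - c * S ^ (q + 1))) atTop atTop :=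
    tendsto_atTop_add_const_right _ _ ((tendsto_rpow_atTop hq).const_mul_atTop hc)
  refine tendsto_atTop_mono' _ ?_ h1
  filter_upwards [eventually_ge_atTop S] with b hb
  have := hF S b le_rfl hb
  linarith

/-- The positive zero `θ` of the primitive. -/
lemma exists_theta (h : Admissible p q γ f) :
    ∃ θ, γ < θ ∧ prim f θ = 0 ∧ ∀ M, 0 < M → (0 ≤ prim f M ↔ θ ≤ M) := by
  have h0 : prim f γ < 0 := h.prim_neg ⟨h.pos_gamma, le_rfl⟩
  obtain ⟨B, hB, hγB⟩ :=
    ((h.tendsto_prim.eventually (eventually_ge_atTop 0)).and (eventually_ge_atTop γ)).exists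
  obtain ⟨θ, hθ, hθ0⟩ := intermediate_value_Icc hγB h.continuous_prim.continuousOn
    (⟨h0.le, hB⟩ : (0 : ℝ) ∈ Icc (prim f γ) (prim f B))
  have hγθ : γ < θ := by
    refine lt_of_le_of_ne hθ.1 ?_
    rintro rfl
    linarith
  refine ⟨θ, hγθ, hθ0, fun M hM => ⟨fun hF => ?_, fun hle => ?_⟩⟩
  · by_contra! hlt
    have := h.prim_lt hθ0.ge hM hlt
    linarith
  · rw [← hθ0]
    exact h.strictMonoOn_prim.monotoneOn hγθ.le (hγθ.le.trans hle) hle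

end Admissible

/-! ### The time map -/

/-- The scaled potential drop `(F(M) - F(Mt)) / M^p`. -/
noncomputable def drop (p : ℝ) (f : ℝ → ℝ) (M t : ℝ) : ℝ := (prim f M - prim f (M * t)) / M ^ p

/-- The integrand `((F(M) - F(Mt)) / M^p)^(-1/p)` of the time map. -/
noncomputable def ker (p : ℝ) (f : ℝ → ℝ) (M t : ℝ) : ℝ := drop p f M t ^ (-(1 / p))

/-- The partial time map: up to a factor depending on the parameter, the distance at which a
solution with maximum `M` at the origin has descended to the height `M t`. -/
noncomputable def tail (p : ℝ) (f : ℝ → ℝ) (M t : ℝ) : ℝ := ∫ s in Ioo t 1, ker p f M s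

/-- The admissible amplitudes: the maxima `M` for which the time map `tail p f M 0` is a
convergent integral. -/
def amplitudes (p : ℝ) (f : ℝ → ℝ) : Set ℝ :=
  {M | 0 < M ∧ 0 ≤ prim f M ∧ IntegrableOn (ker p f M) (Ioo 0 1)}

/-- If `k` vanishes to first order at the left end point and is positive elsewhere, then
`k^(-1/p)` is integrable for `p > 1`. -/
lemma integrableOn_rpow_neg_of_hasDerivAt {p b d : ℝ} (hp : 1 < p) {k : ℝ → ℝ}
    (hk : HasDerivAt k d 0) (hd : 0 < d) (h0 : k 0 = 0) (hc : ContinuousOn k (Icc 0 b))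
    (hpos : ∀ t ∈ Ioo 0 b, 0 < k t) (hb : 0 < b) {b' : ℝ} (hb' : b' < b) :
    IntegrableOn (fun t => k t ^ (-(1 / p))) (Ioo 0 b') := by
  have hp0 : 0 < p := by linarith
  have hev : ∀ᶠ t in 𝓝[>] (0 : ℝ), d / 2 * t ≤ k t := by
    have h1 := (hasDerivAt_iff_tendsto_slope.1 hk).mono_left
      (nhdsWithin_mono 0 fun x (hx : 0 < x) => hx.ne')
    filter_upwards [h1.eventually (lt_mem_nhds (half_lt_self hd)), self_mem_nhdsWithin]
      with t ht ht0
    have ht0' : (0 : ℝ) < t := ht0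
    rw [slope_def_field, h0, sub_zero, sub_zero, lt_div_iff₀ ht0'] at ht
    exact ht.le
  obtain ⟨δ, hδ, hδk⟩ := mem_nhdsGT_iff_exists_Ioo_subset.1 hev
  have hδ' : (0 : ℝ) < δ := hδ
  set e := min δ b / 2 with he
  have he0 : 0 < e := by positivity
  have heδ : e < δ := by have := min_le_left δ b; linarith [lt_min hδ' hb]
  have heb : e < b := by have := min_le_right δ b; linarith [lt_min hδ' hb]
  have hmeas : AEStronglyMeasurable (fun t => k t ^ (-(1 / p))) (volume.restrict (Ioo 0 e)) := by
    refine ContinuousOn.aestronglyMeasurable ?_ measurableSet_Ioo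
    intro t ht
    have htb : t ∈ Ioo 0 b := ⟨ht.1, ht.2.trans heb⟩
    exact ((hc t (Ioo_subset_Icc_self htb)).mono fun s hs =>
      ⟨hs.1.le, (hs.2.trans heb).le⟩).rpow_const (Or.inl (hpos t htb).ne')
  have hA : IntegrableOn (fun t => k t ^ (-(1 / p))) (Ioo 0 e) := by
    have hb1 : IntegrableOn (fun t : ℝ => (d / 2) ^ (-(1 / p)) * t ^ (-(1 / p))) (Ioo 0 e) := by
      have hr : -1 < -(1 / p) := by
        have : 1 / p < 1 := by rw [div_lt_one hp0]; exact hp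
        linarith
      have := (intervalIntegral.intervalIntegrable_rpow' (a := 0) (b := e) hr)
      rw [intervalIntegrable_iff_integrableOn_Ioo_of_le he0.le] at this
      exact this.const_mul _
    refine hb1.mono' hmeas ?_
    filter_upwards [ae_restrict_mem measurableSet_Ioo] with t ht
    have h1 : d / 2 * t ≤ k t := hδk ⟨ht.1, ht.2.trans heδ⟩
    have h2 : 0 < d / 2 * t := by have := ht.1; positivity
    rw [Real.norm_of_nonneg (Real.rpow_nonneg (h2.le.trans h1) _),
      ← Real.mul_rpow (by positivity) ht.1.le]
    exact Real.rpow_le_rpow_of_nonpos h2 h1 (by have : 0 < 1 / p := by positivity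
                                                linarith)
  have hB : IntegrableOn (fun t => k t ^ (-(1 / p))) (Icc e b') := by
    refine ContinuousOn.integrableOn_Icc ?_
    intro t ht
    have htb : t ∈ Ioo 0 b := ⟨he0.trans_le ht.1, ht.2.trans_lt hb'⟩
    exact ((hc t (Ioo_subset_Icc_self htb)).mono fun s hs =>
      ⟨he0.le.trans hs.1, hs.2.trans hb'.le⟩).rpow_const (Or.inl (hpos t htb).ne')
  refine (hA.union hB).mono_set fun t ht => ?_
  rcases lt_or_ge t e with h | h
  · exact Or.inl ⟨ht.1, h⟩
  · exact Or.inr ⟨h, ht.2.le⟩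

lemma tail_one (p : ℝ) (f : ℝ → ℝ) (M : ℝ) : tail p f M 1 = 0 := by simp [tail]

namespace Admissible

variable {p q γ : ℝ} {f : ℝ → ℝ}

lemma continuous_drop (h : Admissible p q γ f) (M : ℝ) : Continuous (drop p f M) :=
  (continuous_const.sub (h.continuous_prim.comp (continuous_const.mul continuous_id))).div_const _

lemma drop_pos (h : Admissible p q γ f) {M t : ℝ} (hM : 0 < M) (hF : 0 ≤ prim f M)
    (ht : t ∈ Ioo 0 1) : 0 < drop p f M t := by
  refine div_pos (sub_pos.2 ?_) (Real.rpow_pos_of_pos hM p)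
  exact h.prim_lt hF (mul_pos hM ht.1) (by nlinarith [ht.2])

lemma ker_pos (h : Admissible p q γ f) {M t : ℝ} (hM : 0 < M) (hF : 0 ≤ prim f M)
    (ht : t ∈ Ioo 0 1) : 0 < ker p f M t :=
  Real.rpow_pos_of_pos (h.drop_pos hM hF ht) _

lemma measurable_ker (h : Admissible p q γ f) (M : ℝ) : Measurable (ker p f M) :=
  (h.continuous_drop M).measurable.pow_const _

lemma continuousOn_ker (h : Admissible p q γ f) {M : ℝ} (hM : 0 < M) (hF : 0 ≤ prim f M) :
    ContinuousOn (ker p f M) (Ioo 0 1) := fun _ ht =>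
  ((h.continuous_drop M).continuousWithinAt).rpow_const (Or.inl (h.drop_pos hM hF ht).ne')

lemma continuousAt_ker (h : Admissible p q γ f) {M t : ℝ} (hM : 0 < M) (hF : 0 ≤ prim f M)
    (ht : t ∈ Ioo 0 1) : ContinuousAt (fun M => ker p f M t) M := by
  refine ContinuousAt.rpow_const ?_ (Or.inl (h.drop_pos hM hF ht).ne')
  refine ContinuousAt.div ?_ (Real.continuousAt_rpow_const _ _ (Or.inl hM.ne'))
    (Real.rpow_pos_of_pos hM p).ne'
  have := h.continuous_prim
  fun_prop

/-- The scaled potential drop increases with the amplitude: its derivative is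
`(H(M) - H(Mt)) / M^(p+1)`. -/
lemma strictMonoOn_drop (h : Admissible p q γ f) {t : ℝ} (ht : t ∈ Ico 0 1) :
    StrictMonoOn (fun M => drop p f M t) (Ioi γ) := by
  have hd : ∀ M, γ < M → HasDerivAt (fun M => drop p f M t)
      ((hump p f M - hump p f (M * t)) / (M * M ^ p)) M := by
    intro M hM
    have hM0 : 0 < M := h.pos_gamma.trans hM
    have hMp := Real.rpow_pos_of_pos hM0 p
    have hlin : HasDerivAt (fun M : ℝ => M * t) t M := by
      simpa using (hasDerivAt_id M).mul_const t
    have hcomp : HasDerivAt (fun M => prim f (M * t)) (f (M * t) * t) M :=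
      HasDerivAt.comp (h₂ := prim f) M (h.hasDerivAt_prim (mul_nonneg hM0.le ht.1)) hlin
    have h1 := (h.hasDerivAt_prim hM0.le).sub hcomp
    have h2 := h1.div (Real.hasDerivAt_rpow_const (p := p) (Or.inl hM0.ne')) hMp.ne'
    refine h2.congr_deriv ?_
    rw [Real.rpow_sub_one hM0.ne', hump, hump, Pi.sub_apply]
    field_simp
    ring
  refine strictMonoOn_of_deriv_pos (convex_Ioi γ)
    (fun M hM => (hd M hM).continuousAt.continuousWithinAt) fun M hM => ?_
  have hM' : γ < M := interior_subset hM
  have hM0 : 0 < M := h.pos_gamma.trans hM'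
  rw [(hd M hM').deriv]
  refine div_pos (sub_pos.2 (h.hump_lt (mul_nonneg hM0.le ht.1) ?_ hM')) (by positivity)
  nlinarith [ht.2]

lemma ker_lt (h : Admissible p q γ f) {M₁ M₂ t : ℝ} (hM : 0 < M₁) (hF : 0 ≤ prim f M₁)
    (h12 : M₁ < M₂) (ht : t ∈ Ioo 0 1) : ker p f M₂ t < ker p f M₁ t := by
  have hγ := h.gamma_lt hM hF
  have hp : 0 < 1 / p := by have := h.one_lt; positivity
  exact Real.rpow_lt_rpow_of_neg (h.drop_pos hM hF ht)
    (h.strictMonoOn_drop ⟨ht.1.le, ht.2⟩ hγ (hγ.trans h12) h12) (by linarith)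

lemma ker_le (h : Admissible p q γ f) {M₁ M₂ t : ℝ} (hM : 0 < M₁) (hF : 0 ≤ prim f M₁)
    (h12 : M₁ ≤ M₂) (ht : t ∈ Ioo 0 1) : ker p f M₂ t ≤ ker p f M₁ t := by
  rcases h12.eq_or_lt with rfl | h12
  · exact le_rfl
  · exact (h.ker_lt hM hF h12 ht).le

lemma prim_nonneg_mono (h : Admissible p q γ f) {M₁ M₂ : ℝ} (hM : 0 < M₁) (hF : 0 ≤ prim f M₁)
    (h12 : M₁ ≤ M₂) : 0 ≤ prim f M₂ := by
  have hγ := h.gamma_lt hM hF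
  exact hF.trans (h.strictMonoOn_prim.monotoneOn hγ.le (hγ.le.trans h12) h12)

lemma integrableOn_ker_mono (h : Admissible p q γ f) {M₁ M₂ : ℝ} (hM : 0 < M₁)
    (hF : 0 ≤ prim f M₁) (h12 : M₁ ≤ M₂) {s : Set ℝ} (hs : s ⊆ Ioo 0 1) (hsm : MeasurableSet s)
    (hi : IntegrableOn (ker p f M₁) s) : IntegrableOn (ker p f M₂) s := by
  refine hi.mono' (h.measurable_ker M₂).aestronglyMeasurable ?_
  filter_upwards [ae_restrict_mem hsm] with t ht
  rw [Real.norm_of_nonneg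
    (h.ker_pos (hM.trans_le h12) (h.prim_nonneg_mono hM hF h12) (hs ht)).le]
  exact h.ker_le hM hF h12 (hs ht)

lemma amplitudes_mono (h : Admissible p q γ f) {M₁ M₂ : ℝ} (hM : M₁ ∈ amplitudes p f)
    (h12 : M₁ ≤ M₂) : M₂ ∈ amplitudes p f :=
  ⟨hM.1.trans_le h12, h.prim_nonneg_mono hM.1 hM.2.1 h12,
    h.integrableOn_ker_mono hM.1 hM.2.1 h12 Subset.rfl measurableSet_Ioo hM.2.2⟩

/-! ### Convergence of the time map -/

lemma integrableOn_ker_right (h : Admissible p q γ f) {M ε : ℝ} (hM : 0 < M) (hF : 0 ≤ prim f M)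
    (hε : 0 < ε) : IntegrableOn (ker p f M) (Ioo ε 1) := by
  have hγ := h.gamma_lt hM hF
  have hMp := Real.rpow_pos_of_pos hM p
  have hd : HasDerivAt (fun t => drop p f M (1 - t)) (M * f M / M ^ p) 0 := by
    have h1 : HasDerivAt (fun t : ℝ => M * (1 - t)) (-M) 0 := by
      simpa using (((hasDerivAt_id (0 : ℝ)).const_sub 1).const_mul M)
    have h2 : HasDerivAt (prim f) (f M) (M * (1 - 0)) := by
      simpa using h.hasDerivAt_prim hM.le
    have h3 := ((h2.comp (0 : ℝ) h1).const_sub (prim f M)).div_const (M ^ p)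
    refine h3.congr_deriv ?_
    ring
  have h1 := integrableOn_rpow_neg_of_hasDerivAt (b := 1) (b' := 1 - ε) h.one_lt hd
    (div_pos (mul_pos hM (h.pos M hγ)) hMp) (by simp [drop])
    ((h.continuous_drop M).comp (continuous_const.sub continuous_id)).continuousOn
    (fun t ht => h.drop_pos hM hF ⟨by linarith [ht.2], by linarith [ht.1]⟩) one_pos (by linarith)
  have h2 : MeasurePreserving (fun t : ℝ => 1 - t) volume volume :=
    Measure.measurePreserving_sub_left volume 1
  have h3 := (h2.integrableOn_comp_preimage
    (Homeomorph.subLeft (1 : ℝ)).measurableEmbedding (f := ker p f M) (s := Ioo ε 1)).1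
  apply h3
  have : (fun t : ℝ => 1 - t) ⁻¹' Ioo ε 1 = Ioo 0 (1 - ε) := by
    ext t; simp only [mem_preimage, mem_Ioo]; constructor <;> rintro ⟨h1, h2⟩ <;>
      constructor <;> linarith
  rw [this]
  exact h1

lemma mem_amplitudes_of_prim_pos (h : Admissible p q γ f) {M : ℝ} (hM : 0 < M)
    (hF : 0 < prim f M) : M ∈ amplitudes p f := by
  refine ⟨hM, hF.le, ?_⟩
  have h1 : IntegrableOn (ker p f M) (Icc 0 (1 / 2)) := by
    refine ContinuousOn.integrableOn_Icc fun t ht => ?_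
    refine (h.continuous_drop M).continuousWithinAt.rpow_const (Or.inl (ne_of_gt ?_))
    rcases ht.1.eq_or_lt with rfl | ht0
    · simpa [drop, prim_zero] using div_pos hF (Real.rpow_pos_of_pos hM p)
    · exact h.drop_pos hM hF.le ⟨ht0, by linarith [ht.2]⟩
  refine (h1.union (h.integrableOn_ker_right hM hF.le (by norm_num : (0 : ℝ) < 1 / 2))).mono_set
    fun t ht => ?_
  rcases le_or_gt t (1 / 2) with hl | hl
  · exact Or.inl ⟨ht.1.le, hl⟩
  · exact Or.inr ⟨hl, ht.2⟩

lemma mem_amplitudes_of_zero_neg (h : Admissible p q γ f) (h0 : f 0 < 0) {M : ℝ} (hM : 0 < M)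
    (hF : prim f M = 0) : M ∈ amplitudes p f := by
  refine ⟨hM, hF.ge, ?_⟩
  have hMp := Real.rpow_pos_of_pos hM p
  have hd : HasDerivAt (drop p f M) (-(f 0 * M) / M ^ p) 0 := by
    have h1 : HasDerivAt (fun t : ℝ => M * t) M 0 := by
      simpa using ((hasDerivAt_id (0 : ℝ)).const_mul M)
    have h2 : HasDerivAt (prim f) (f 0) (M * 0) := by
      simpa using h.hasDerivAt_prim le_rfl
    exact ((h2.comp (0 : ℝ) h1).const_sub (prim f M)).div_const (M ^ p)
  have h1 := integrableOn_rpow_neg_of_hasDerivAt (b := 1) (b' := 1 / 2 + 1 / 4) h.one_lt hd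
    (div_pos (by nlinarith) hMp) (by simp [drop, prim_zero, hF])
    (h.continuous_drop M).continuousOn
    (fun t ht => h.drop_pos hM hF.ge ht) one_pos (by norm_num)
  refine (IntegrableOn.union h1
    (h.integrableOn_ker_right hM hF.ge (by norm_num : (0 : ℝ) < 1 / 2))).mono_set fun t ht => ?_
  rcases le_or_gt t (1 / 2) with hl | hl
  · exact Or.inl ⟨ht.1, by linarith⟩
  · exact Or.inr ⟨hl, ht.2⟩

/-- If `-f` is bounded by a multiple of `s^(p-1)` near `0`, the time map diverges at the zero of
`F`, since its integrand dominates a multiple of `1/t`. -/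
lemma notMem_amplitudes (h : Admissible p q γ f)
    (hH : ∃ c₀ > 0, ∀ᶠ s in 𝓝[>] (0 : ℝ), -f s < c₀ * s ^ (p - 1)) {M : ℝ}
    (hF : prim f M = 0) : M ∉ amplitudes p f := by
  rintro ⟨hM, -, hi⟩
  obtain ⟨c, hc, hev⟩ := hH
  obtain ⟨δ, hδ, hδf⟩ := mem_nhdsGT_iff_exists_Ioo_subset.1 hev
  have hδ' : (0 : ℝ) < δ := hδ
  have hp0 : 0 < p := by linarith [h.one_lt]
  have hmono : MonotoneOn (fun s => prim f s + c / p * s ^ p) (Ico 0 δ) := by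
    have hd : ∀ s, 0 < s → HasDerivAt (fun s => prim f s + c / p * s ^ p)
        (f s + c / p * (p * s ^ (p - 1))) s := fun s hs =>
      (h.hasDerivAt_prim hs.le).add
        ((Real.hasDerivAt_rpow_const (Or.inl hs.ne')).const_mul _)
    refine monotoneOn_of_deriv_nonneg (convex_Ico 0 δ) ?_ ?_ ?_
    · refine (h.continuous_prim.add (continuous_const.mul ?_)).continuousOn
      exact Real.continuous_rpow_const hp0.le
    · intro s hs
      rw [interior_Ico] at hs
      exact (hd s hs.1).differentiableAt.differentiableWithinAt
    · intro s hs
      rw [interior_Ico] at hs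
      rw [(hd s hs.1).deriv]
      have h1 : -f s < c * s ^ (p - 1) := hδf hs
      have h2 : c / p * (p * s ^ (p - 1)) = c * s ^ (p - 1) := by field_simp
      linarith
  set e := min (δ / M) 1 with he
  have he0 : 0 < e := lt_min (by positivity) one_pos
  have hbound : ∀ t ∈ Ioo 0 e, (c / p) ^ (-(1 / p)) * t⁻¹ ≤ ker p f M t := by
    intro t ht
    have ht1 : t ∈ Ioo 0 1 := ⟨ht.1, ht.2.trans_le (min_le_right _ _)⟩
    have hMt : M * t < δ := by
      have := ht.2.trans_le (min_le_left _ _)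
      rwa [lt_div_iff₀ hM, mul_comm] at this
    have h1 := hmono ⟨le_rfl, hδ'⟩ ⟨(mul_pos hM ht.1).le, hMt⟩ (mul_pos hM ht.1).le
    simp only [prim_zero, Real.zero_rpow hp0.ne', mul_zero, add_zero] at h1
    have h2 : drop p f M t ≤ c / p * t ^ p := by
      rw [drop, hF, div_le_iff₀ (Real.rpow_pos_of_pos hM p), mul_assoc, mul_comm (t ^ p),
        ← Real.mul_rpow hM.le ht.1.le]
      linarith
    have h3 : (c / p * t ^ p) ^ (-(1 / p)) ≤ ker p f M t :=
      Real.rpow_le_rpow_of_nonpos (h.drop_pos hM hF.ge ht1) h2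
        (by have : 0 < 1 / p := by positivity
            linarith)
    refine le_trans (le_of_eq ?_) h3
    rw [Real.mul_rpow (by positivity) (Real.rpow_nonneg ht.1.le _), ← Real.rpow_mul ht.1.le]
    congr 1
    rw [← Real.rpow_neg_one]
    congr 1
    field_simp
  have hinv : IntegrableOn (fun t : ℝ => (c / p) ^ (-(1 / p)) * t⁻¹) (Ioo 0 e) := by
    refine (hi.mono_set (Ioo_subset_Ioo_right (min_le_right _ _))).mono'
      (measurable_inv.const_mul _).aestronglyMeasurable ?_
    filter_upwards [ae_restrict_mem measurableSet_Ioo] with t ht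
    have := ht.1
    rw [Real.norm_of_nonneg (by positivity)]
    exact hbound t ht
  have hne : (c / p) ^ (-(1 / p)) ≠ 0 := (Real.rpow_pos_of_pos (by positivity) _).ne'
  generalize (c / p) ^ (-(1 / p)) = K at hinv hne
  have hinv' : IntegrableOn (fun t : ℝ => t⁻¹) (Ioo 0 e) := by
    have := hinv.const_mul K⁻¹
    simpa [IntegrableOn, ← mul_assoc, inv_mul_cancel₀ hne] using this
  have h4 := (intervalIntegrable_iff_integrableOn_Ioo_of_le he0.le).2 hinv'
  rw [intervalIntegrable_inv_iff] at h4
  rcases h4 with h4 | h4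
  · exact he0.ne h4
  · exact h4 left_mem_uIcc

end Admissible

/-! ### Continuity, monotonicity and range of the time map -/

lemma tail_eq_intervalIntegral (p : ℝ) (f : ℝ → ℝ) (M : ℝ) {t : ℝ} (ht : t ≤ 1) :
    tail p f M t = ∫ s in t..1, ker p f M s := by
  rw [tail, intervalIntegral.integral_of_le ht, integral_Ioc_eq_integral_Ioo]

lemma intervalIntegrable_ker {p : ℝ} {f : ℝ → ℝ} {M : ℝ} (hM : M ∈ amplitudes p f) {s t : ℝ}
    (hs : s ∈ Icc 0 1) (ht : t ∈ Icc 0 1) : IntervalIntegrable (ker p f M) volume s t := by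
  have h1 : IntervalIntegrable (ker p f M) volume 0 1 :=
    (intervalIntegrable_iff_integrableOn_Ioo_of_le zero_le_one).2 hM.2.2
  refine h1.mono_set ?_
  rw [uIcc_of_le (zero_le_one' ℝ)]
  exact uIcc_subset_Icc hs ht

lemma tail_sub {p : ℝ} {f : ℝ → ℝ} {M : ℝ} (hM : M ∈ amplitudes p f) {s t : ℝ} (hs : s ∈ Icc 0 1)
    (ht : t ∈ Icc 0 1) : tail p f M s - tail p f M t = ∫ r in s..t, ker p f M r := by
  rw [tail_eq_intervalIntegral p f M hs.2, tail_eq_intervalIntegral p f M ht.2, sub_eq_iff_eq_add,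
    intervalIntegral.integral_add_adjacent_intervals (intervalIntegrable_ker hM hs ht)
      (intervalIntegrable_ker hM ht ⟨zero_le_one, le_rfl⟩)]

lemma continuousOn_tail {p : ℝ} {f : ℝ → ℝ} {M : ℝ} (hM : M ∈ amplitudes p f) :
    ContinuousOn (tail p f M) (Icc 0 1) := by
  have h1 : IntegrableOn (ker p f M) (uIcc 0 1) := by
    rw [uIcc_of_le (zero_le_one' ℝ), integrableOn_Icc_iff_integrableOn_Ioo]
    exact hM.2.2
  have h2 := intervalIntegral.continuousOn_primitive_interval_left h1
  rw [uIcc_of_le (zero_le_one' ℝ)] at h2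
  exact h2.congr fun t ht => tail_eq_intervalIntegral p f M ht.2

lemma abs_tail_sub_le {p : ℝ} {f : ℝ → ℝ} {M M₀ : ℝ} (hM : M ∈ amplitudes p f)
    (hM₀ : M₀ ∈ amplitudes p f) {t : ℝ} (ht : t ∈ Icc 0 1) :
    |tail p f M t - tail p f M₀ t| ≤ ∫ t in Ioo 0 1, |ker p f M t - ker p f M₀ t| := by
  have hsub : Ioo t 1 ⊆ Ioo 0 1 := Ioo_subset_Ioo_left ht.1
  rw [tail, tail, ← integral_sub (hM.2.2.mono_set hsub) (hM₀.2.2.mono_set hsub)]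
  refine (abs_integral_le_integral_abs).trans ?_
  exact setIntegral_mono_set (hM.2.2.sub hM₀.2.2).abs
    (Eventually.of_forall fun t => abs_nonneg _) hsub.eventuallyLE

namespace Admissible

variable {p q γ : ℝ} {f : ℝ → ℝ}

lemma strictAntiOn_tail (h : Admissible p q γ f) {M : ℝ} (hM : M ∈ amplitudes p f) :
    StrictAntiOn (tail p f M) (Icc 0 1) := by
  intro s hs t ht hst
  rw [← sub_pos, tail_sub hM hs ht]
  refine intervalIntegral.intervalIntegral_pos_of_pos_on (intervalIntegrable_ker hM hs ht)
    (fun r hr => h.ker_pos hM.1 hM.2.1 ⟨hs.1.trans_lt hr.1, hr.2.trans_le ht.2⟩) hst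

lemma hasDerivAt_tail (h : Admissible p q γ f) {M t : ℝ} (hM : M ∈ amplitudes p f)
    (ht : t ∈ Ioo 0 1) : HasDerivAt (tail p f M) (-ker p f M t) t := by
  have h1 := intervalIntegral.integral_hasDerivAt_left
    (intervalIntegrable_ker hM (Ioo_subset_Icc_self ht) ⟨zero_le_one, le_rfl⟩)
    (h.measurable_ker M).stronglyMeasurable.stronglyMeasurableAtFilter
    ((h.continuousOn_ker hM.1 hM.2.1).continuousAt (Ioo_mem_nhds ht.1 ht.2))
  refine h1.congr_of_eventuallyEq ?_
  filter_upwards [Iio_mem_nhds ht.2] with s hs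
  exact tail_eq_intervalIntegral p f M (le_of_lt hs)

lemma tail_nonneg (h : Admissible p q γ f) {M t : ℝ} (hM : M ∈ amplitudes p f)
    (ht : t ∈ Icc 0 1) : 0 ≤ tail p f M t := by
  rw [← tail_one p f M]
  exact (h.strictAntiOn_tail hM).antitoneOn ht ⟨zero_le_one, le_rfl⟩ ht.2

lemma tail_zero_pos (h : Admissible p q γ f) {M : ℝ} (hM : M ∈ amplitudes p f) :
    0 < tail p f M 0 := by
  have := h.strictAntiOn_tail hM ⟨le_rfl, zero_le_one⟩ ⟨zero_le_one, le_rfl⟩ one_pos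
  rwa [tail_one] at this

/-- The time map is strictly decreasing. -/
lemma strictAntiOn_timeMap (h : Admissible p q γ f) :
    StrictAntiOn (fun M => tail p f M 0) (amplitudes p f) := by
  intro M₁ h₁ M₂ h₂ h12
  have hk : ∀ t ∈ Ioo (0 : ℝ) 1, ker p f M₂ t < ker p f M₁ t := fun t ht =>
    h.ker_lt h₁.1 h₁.2.1 h12 ht
  simp only [tail]
  have hsub : 0 < ∫ t in (0 : ℝ)..1, (ker p f M₁ t - ker p f M₂ t) :=
    intervalIntegral.intervalIntegral_pos_of_pos_on
      ((intervalIntegrable_ker h₁ ⟨le_rfl, zero_le_one⟩ ⟨zero_le_one, le_rfl⟩).sub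
        (intervalIntegrable_ker h₂ ⟨le_rfl, zero_le_one⟩ ⟨zero_le_one, le_rfl⟩))
      (fun t ht => sub_pos.2 (hk t ht)) one_pos
  rw [intervalIntegral.integral_of_le zero_le_one, integral_Ioc_eq_integral_Ioo,
    integral_sub h₁.2.2 h₂.2.2] at hsub
  linarith

/-- The integrands of the time map depend continuously on the amplitude in `L¹`. The domination
comes from their monotonicity in the amplitude. -/
lemma tendsto_integral_abs_ker_sub (h : Admissible p q γ f) {M₀ : ℝ}
    (hM₀ : M₀ ∈ amplitudes p f) :
    Tendsto (fun M => ∫ t in Ioo 0 1, |ker p f M t - ker p f M₀ t|) (𝓝[amplitudes p f] M₀)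
      (𝓝 0) := by
  obtain ⟨M₁, hM₁, hle₀, hev⟩ : ∃ M₁ ∈ amplitudes p f, M₁ ≤ M₀ ∧
      ∀ᶠ M in 𝓝[amplitudes p f] M₀, M₁ ≤ M := by
    by_cases hex : ∃ M₁ ∈ amplitudes p f, M₁ < M₀
    · obtain ⟨M₁, hM₁, hlt⟩ := hex
      exact ⟨M₁, hM₁, hlt.le, mem_nhdsWithin_of_mem_nhds (Ici_mem_nhds hlt)⟩
    · push Not at hex
      exact ⟨M₀, hM₀, le_rfl, by filter_upwards [self_mem_nhdsWithin] with M hM using hex M hM⟩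
  suffices hlim : Tendsto (fun M => ∫ t in Ioo 0 1, |ker p f M t - ker p f M₀ t|)
      (𝓝[amplitudes p f] M₀) (𝓝 (∫ t in Ioo 0 1, |ker p f M₀ t - ker p f M₀ t|)) by
    simpa using hlim
  refine tendsto_integral_filter_of_dominated_convergence
    (fun t => ker p f M₁ t + ker p f M₁ t) ?_ ?_ (hM₁.2.2.add hM₁.2.2) ?_
  · refine Eventually.of_forall fun M => ?_
    exact (((h.measurable_ker M).sub (h.measurable_ker M₀)).abs).aestronglyMeasurable
  · filter_upwards [hev] with M hM
    filter_upwards [ae_restrict_mem measurableSet_Ioo] with t ht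
    have h1 := h.ker_le hM₁.1 hM₁.2.1 hM ht
    have h2 := h.ker_le hM₁.1 hM₁.2.1 hle₀ ht
    have hMA := h.amplitudes_mono hM₁ hM
    have h3 := h.ker_pos hMA.1 hMA.2.1 ht
    have h4 := h.ker_pos hM₀.1 hM₀.2.1 ht
    rw [Real.norm_eq_abs, abs_abs, abs_le]
    constructor <;> linarith
  · filter_upwards [ae_restrict_mem measurableSet_Ioo] with t ht
    have h1 := (h.continuousAt_ker hM₀.1 hM₀.2.1 ht).tendsto
    exact ((h1.mono_left nhdsWithin_le_nhds).sub_const _).abs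

lemma continuousOn_timeMap (h : Admissible p q γ f) :
    ContinuousOn (fun M => tail p f M 0) (amplitudes p f) := by
  intro M₀ hM₀
  rw [ContinuousWithinAt, tendsto_iff_norm_sub_tendsto_zero]
  refine squeeze_zero' (Eventually.of_forall fun _ => norm_nonneg _) ?_
    (h.tendsto_integral_abs_ker_sub hM₀)
  filter_upwards [self_mem_nhdsWithin] with M hM
  exact abs_tail_sub_le hM hM₀ ⟨le_rfl, zero_le_one⟩

lemma exists_mem_amplitudes (h : Admissible p q γ f) : ∃ M, M ∈ amplitudes p f := by
  obtain ⟨M, hM, hM0⟩ :=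
    ((h.tendsto_prim.eventually (eventually_gt_atTop 0)).and (eventually_gt_atTop 0)).exists
  exact ⟨M, h.mem_amplitudes_of_prim_pos hM0 hM⟩

/-- The scaled potential drop tends to infinity with the amplitude, since `q + 1 > p`. -/
lemma tendsto_drop (h : Admissible p q γ f) {t : ℝ} (ht : t ∈ Ioo 0 1) :
    Tendsto (fun M => drop p f M t) atTop atTop := by
  obtain ⟨c, hc, S, hS, hF⟩ := h.exists_prim_growth
  have hq : 0 < q + 1 := by linarith [h.one_lt, h.lt_q]
  have hlt : t ^ (q + 1) < 1 := Real.rpow_lt_one ht.1.le ht.2 hq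
  have h1 : Tendsto (fun M : ℝ => c * (1 - t ^ (q + 1)) * M ^ (q + 1 - p)) atTop atTop :=
    (tendsto_rpow_atTop (by linarith [h.lt_q])).const_mul_atTop (mul_pos hc (by linarith))
  refine tendsto_atTop_mono' _ ?_ h1
  filter_upwards [eventually_ge_atTop (S / t), eventually_gt_atTop 0] with M hM hM0
  have hMt : S ≤ M * t := by rwa [div_le_iff₀ ht.1] at hM
  have h2 := hF (M * t) M hMt (by nlinarith [ht.2])
  rw [drop, le_div_iff₀ (Real.rpow_pos_of_pos hM0 p), mul_assoc, ← Real.rpow_add hM0,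
    sub_add_cancel]
  rw [Real.mul_rpow hM0.le ht.1.le] at h2
  linarith

lemma tendsto_timeMap (h : Admissible p q γ f) :
    Tendsto (fun M => tail p f M 0) atTop (𝓝 0) := by
  obtain ⟨M₁, hM₁⟩ := h.exists_mem_amplitudes
  suffices hlim : Tendsto (fun M => tail p f M 0) atTop (𝓝 (∫ t in Ioo (0 : ℝ) 1, (0 : ℝ))) by
    simpa using hlim
  refine tendsto_integral_filter_of_dominated_convergence (ker p f M₁) ?_ ?_ hM₁.2.2 ?_
  · exact Eventually.of_forall fun M => (h.measurable_ker M).aestronglyMeasurable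
  · filter_upwards [eventually_ge_atTop M₁] with M hM
    filter_upwards [ae_restrict_mem measurableSet_Ioo] with t ht
    have hMA := h.amplitudes_mono hM₁ hM
    rw [Real.norm_of_nonneg (h.ker_pos hMA.1 hMA.2.1 ht).le]
    exact h.ker_le hM₁.1 hM₁.2.1 hM ht
  · filter_upwards [ae_restrict_mem measurableSet_Ioo] with t ht
    exact (tendsto_rpow_neg_atTop (by have := h.one_lt; positivity)).comp (h.tendsto_drop ht)

/-- If the time map diverges at the zero `θ` of the primitive, it is unbounded on `(θ, ∞)`, by
Fatou's lemma. -/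
lemma exists_lt_timeMap (h : Admissible p q γ f) {θ : ℝ} (hθ : 0 < θ) (hF : prim f θ = 0)
    (hθA : θ ∉ amplitudes p f) (hA : ∀ M, θ < M → M ∈ amplitudes p f) (C : ℝ) :
    ∃ M ∈ amplitudes p f, C < tail p f M 0 := by
  by_contra! hle
  apply hθA
  refine ⟨hθ, hF.ge, (h.measurable_ker θ).aestronglyMeasurable, ?_⟩
  let x : ℕ → ℝ := fun n => θ + 1 / ((n : ℝ) + 1)
  have hx : Tendsto x atTop (𝓝 θ) := by
    have := (tendsto_one_div_add_atTop_nhds_zero_nat (𝕜 := ℝ)).const_add θ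
    simpa only [add_zero] using this
  have hxA : ∀ n, x n ∈ amplitudes p f := fun n => hA _ (lt_add_of_pos_right θ (by positivity))
  have h1 := lintegral_liminf_le' (μ := volume.restrict (Ioo (0 : ℝ) 1)) (u := atTop)
    (f := fun n t => ‖ker p f (x n) t‖ₑ)
    (fun n => (h.measurable_ker (x n)).enorm.aemeasurable)
  have h2 : ∫⁻ t in Ioo (0 : ℝ) 1, ‖ker p f θ t‖ₑ =
      ∫⁻ t in Ioo (0 : ℝ) 1, liminf (fun n => ‖ker p f (x n) t‖ₑ) atTop := by
    refine setLIntegral_congr_fun measurableSet_Ioo fun t ht => ?_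
    have h3 := ((h.continuousAt_ker hθ hF.ge ht).tendsto.comp hx).enorm
    exact h3.liminf_eq.symm
  have h3 : ∀ n, ∫⁻ t in Ioo (0 : ℝ) 1, ‖ker p f (x n) t‖ₑ ≤ ENNReal.ofReal C := by
    intro n
    have h4 : ∫⁻ t in Ioo (0 : ℝ) 1, ‖ker p f (x n) t‖ₑ = ENNReal.ofReal (tail p f (x n) 0) := by
      rw [tail, ofReal_integral_eq_lintegral_ofReal (hxA n).2.2]
      · refine setLIntegral_congr_fun measurableSet_Ioo fun t ht => ?_
        exact Real.enorm_of_nonneg (h.ker_pos (hxA n).1 (hxA n).2.1 ht).le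
      · filter_upwards [ae_restrict_mem measurableSet_Ioo] with t ht
        exact (h.ker_pos (hxA n).1 (hxA n).2.1 ht).le
    rw [h4]
    exact ENNReal.ofReal_le_ofReal (hle _ (hxA n))
  rw [HasFiniteIntegral, h2]
  refine h1.trans_lt ((liminf_le_of_frequently_le' (Frequently.of_forall h3)).trans_lt
    ENNReal.ofReal_lt_top)

lemma exists_timeMap_eq (h : Admissible p q γ f) {M₁ y : ℝ} (hM₁ : M₁ ∈ amplitudes p f)
    (hy : 0 < y) (hle : y ≤ tail p f M₁ 0) : ∃ M ∈ amplitudes p f, tail p f M 0 = y := by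
  obtain ⟨B, hB, hMB⟩ :=
    ((h.tendsto_timeMap.eventually (gt_mem_nhds hy)).and (eventually_ge_atTop M₁)).exists
  obtain ⟨M, hM, hMy⟩ := intermediate_value_Icc' hMB
    (h.continuousOn_timeMap.mono fun M hM => h.amplitudes_mono hM₁ hM.1)
    (⟨hB.le, hle⟩ : y ∈ Icc (tail p f B 0) (tail p f M₁ 0))
  exact ⟨M, h.amplitudes_mono hM₁ hM.1, hMy⟩

end Admissible

/-! ### The function `φ` -/

lemma phi_zero (p : ℝ) : phi p 0 = 0 := by simp [phi]

lemma phi_neg (p t : ℝ) : phi p (-t) = -phi p t := by simp [phi]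

lemma phi_ne_zero {p t : ℝ} (ht : t ≠ 0) : phi p t ≠ 0 :=
  mul_ne_zero ht (Real.rpow_pos_of_pos (abs_pos.2 ht) _).ne'

lemma hasDerivAt_phi (p : ℝ) {t : ℝ} (ht : t ≠ 0) :
    HasDerivAt (phi p) ((p - 1) * |t| ^ (p - 2)) t := by
  have h1 : HasDerivAt (fun t : ℝ => |t| ^ (p - 2))
      (SignType.sign t * (p - 2) * |t| ^ (p - 2 - 1)) t :=
    (hasDerivAt_abs ht).rpow_const (Or.inl (abs_ne_zero.2 ht))
  refine ((hasDerivAt_id t).mul h1).congr_deriv ?_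
  simp only [id]
  have h2 : t * (SignType.sign t : ℝ) = |t| := by
    rw [mul_comm, sign_mul_self]
  have h3 : |t| ^ (p - 2) = |t| * |t| ^ (p - 2 - 1) := by
    rw [Real.rpow_sub_one (abs_ne_zero.2 ht)]
    field_simp [abs_ne_zero.2 ht]
  linear_combination (p - 2) * |t| ^ (p - 2 - 1) * h2 - (p - 2) * h3

lemma deriv_phi_pos {p t : ℝ} (hp : 1 < p) (ht : t ≠ 0) : 0 < deriv (phi p) t := by
  rw [(hasDerivAt_phi p ht).deriv]
  exact mul_pos (by linarith) (Real.rpow_pos_of_pos (abs_pos.2 ht) _)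

lemma deriv_phi_mul {p t : ℝ} (ht : t ≠ 0) : deriv (phi p) t * t = (p - 1) * phi p t := by
  rw [(hasDerivAt_phi p ht).deriv, phi]
  ring

/-- The inverse of `φ` is the function of the same form with the conjugate exponent. -/
lemma phi_conj_phi {p : ℝ} (hp : 1 < p) (t : ℝ) : phi (p / (p - 1)) (phi p t) = t := by
  rcases eq_or_ne t 0 with rfl | ht
  · simp [phi]
  · have ha := abs_pos.2 ht
    have h1 : |phi p t| = |t| ^ (p - 1) := by
      rw [phi, abs_mul, abs_of_pos (Real.rpow_pos_of_pos ha _), Real.rpow_sub_one ha.ne',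
        show p - 2 = p - 1 - 1 by ring, Real.rpow_sub_one ha.ne', Real.rpow_sub_one ha.ne']
      field_simp
    have hp1 : p - 1 ≠ 0 := by linarith
    rw [phi, h1, ← Real.rpow_mul ha.le, phi, mul_assoc, ← Real.rpow_add ha]
    have : p - 2 + (p - 1) * (p / (p - 1) - 2) = 0 := by field_simp; ring
    rw [this, Real.rpow_zero, mul_one]

lemma abs_phi {p : ℝ} (hp : 1 < p) (t : ℝ) : |phi p t| = |t| ^ (p - 1) := by
  rcases eq_or_ne t 0 with rfl | ht
  · simp [phi, Real.zero_rpow (sub_pos.2 hp).ne']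
  · have ha := abs_pos.2 ht
    rw [phi, abs_mul, abs_of_pos (Real.rpow_pos_of_pos ha _),
      show p - 2 = p - 1 - 1 by ring, Real.rpow_sub_one ha.ne']
    field_simp

lemma phi_of_nonneg {p t : ℝ} (hp : 1 < p) (ht : 0 ≤ t) : phi p t = t ^ (p - 1) := by
  have h1 : 0 ≤ phi p t := mul_nonneg ht (Real.rpow_nonneg (abs_nonneg t) _)
  rw [← abs_of_nonneg h1, abs_phi hp, abs_of_nonneg ht]

/-! ### Solutions and their speed -/

lemma eq_left_of_hasDerivAt_zero {a b : ℝ} {k : ℝ → ℝ} (hc : ContinuousOn k (Icc a b))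
    (hd : ∀ x ∈ Ioo a b, HasDerivAt k 0 x) {x : ℝ} (hx : x ∈ Icc a b) : k x = k a := by
  rcases hx.1.eq_or_lt with rfl | hlt
  · rfl
  · obtain ⟨c, hc, hs⟩ := exists_hasDerivAt_eq_slope k (fun _ => 0) hlt
      (hc.mono (Icc_subset_Icc_right hx.2)) fun y hy => hd y ⟨hy.1, hy.2.trans_le hx.2⟩
    rw [eq_div_iff (sub_pos.2 hlt).ne'] at hs
    linarith

/-- The speed `|u'|` at height `s` of a solution with maximum `M`, as given by the conservation
of energy. -/
noncomputable def speed (p : ℝ) (f : ℝ → ℝ) (lam M s : ℝ) : ℝ :=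
  (p / (p - 1) * lam * (prim f M - prim f s)) ^ (1 / p)

namespace IsPositiveSolution

variable {p lam : ℝ} {f u : ℝ → ℝ}

lemma hasDerivWithinAt (hu : IsPositiveSolution p f lam u) {x : ℝ} (hx : x ∈ Icc (-1 : ℝ) 1) :
    HasDerivWithinAt u (D u x) (Icc (-1) 1) x :=
  (hu.contDiffOn.differentiableOn one_ne_zero x hx).hasDerivWithinAt

lemma hasDerivAt (hu : IsPositiveSolution p f lam u) {x : ℝ} (hx : x ∈ Ioo (-1 : ℝ) 1) :
    HasDerivAt u (D u x) x :=
  (hu.hasDerivWithinAt (Ioo_subset_Icc_self hx)).hasDerivAt (Icc_mem_nhds hx.1 hx.2)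

lemma continuousOn (hu : IsPositiveSolution p f lam u) : ContinuousOn u (Icc (-1) 1) :=
  hu.contDiffOn.continuousOn

lemma continuousOn_D (hu : IsPositiveSolution p f lam u) : ContinuousOn (D u) (Icc (-1) 1) :=
  hu.contDiffOn.continuousOn_derivWithin (uniqueDiffOn_Icc (by norm_num)) le_rfl

lemma nonneg (hu : IsPositiveSolution p f lam u) {x : ℝ} (hx : x ∈ Icc (-1 : ℝ) 1) :
    0 ≤ u x := by
  rcases hx.1.eq_or_lt with rfl | h1
  · exact hu.left.ge
  · rcases hx.2.eq_or_lt with rfl | h2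
    · exact hu.right.ge
    · exact (hu.pos x ⟨h1, h2⟩).le

end IsPositiveSolution

/-! ### Reflection and conservation of energy -/

lemma D_comp_neg {u : ℝ → ℝ} (x : ℝ) : D (fun y => u (-y)) x = -D u (-x) := by
  have := derivWithin_comp_neg u (Icc (-1 : ℝ) 1) x
  simpa [D] using this

namespace IsPositiveSolution

variable {p q γ lam : ℝ} {f u : ℝ → ℝ}

lemma comp_neg (hu : IsPositiveSolution p f lam u) :
    IsPositiveSolution p f lam fun x => u (-x) where
  contDiffOn := hu.contDiffOn.comp contDiff_neg.contDiffOn fun x hx => by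
    exact ⟨by linarith [hx.2], by linarith [hx.1]⟩
  equation x hx := by
    have hx' : -x ∈ Ioo (-1 : ℝ) 1 := ⟨by linarith [hx.2], by linarith [hx.1]⟩
    have h1 := ((hu.equation (-x) hx').comp x (hasDerivAt_neg x)).neg
    simp only [D_comp_neg, phi_neg]
    exact h1.congr_deriv (by simp)
  left := by simpa using hu.right
  right := hu.left
  pos x hx := hu.pos (-x) ⟨by linarith [hx.2], by linarith [hx.1]⟩

/-- Conservation of energy. -/
lemma energy (hu : IsPositiveSolution p f lam u) (h : Admissible p q γ f) {x y : ℝ}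
    (hx : x ∈ Icc (-1 : ℝ) 1) (hy : y ∈ Icc (-1 : ℝ) 1) :
    (p - 1) / p * |D u x| ^ p + lam * prim f (u x) =
      (p - 1) / p * |D u y| ^ p + lam * prim f (u y) := by
  have hp := h.one_lt
  have hp0 : 0 < p := by linarith
  have hp1 : 0 < p - 1 := by linarith
  have hr : 1 < p / (p - 1) := by rw [one_lt_div hp1]; linarith
  have hpow : ∀ t : ℝ, |t| ^ p = |phi p t| ^ (p / (p - 1)) := fun t => by
    rw [abs_phi hp, ← Real.rpow_mul (abs_nonneg t)]
    congr 1
    field_simp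
  have hc : ContinuousOn (fun x => (p - 1) / p * |D u x| ^ p + lam * prim f (u x))
      (Icc (-1) 1) :=
    (continuousOn_const.mul ((hu.continuousOn_D.abs).rpow_const fun _ _ => Or.inr hp0.le)).add
      (continuousOn_const.mul (h.continuous_prim.comp_continuousOn hu.continuousOn))
  have hd : ∀ x ∈ Ioo (-1 : ℝ) 1,
      HasDerivAt (fun x => (p - 1) / p * |D u x| ^ p + lam * prim f (u x)) 0 x := by
    intro x hx
    have h1 : HasDerivAt (fun x => |phi p (D u x)| ^ (p / (p - 1)))
        (p / (p - 1) * |phi p (D u x)| ^ (p / (p - 1) - 2) * phi p (D u x) *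
          -(lam * f (u x))) x :=
      HasDerivAt.comp (h₂ := fun y : ℝ => |y| ^ (p / (p - 1))) x
        (hasDerivAt_abs_rpow (phi p (D u x)) hr) (hu.equation x hx)
    have h2 : |phi p (D u x)| ^ (p / (p - 1) - 2) * phi p (D u x) = D u x := by
      rw [mul_comm]
      exact phi_conj_phi hp (D u x)
    have h3 : HasDerivAt (fun x => prim f (u x)) (f (u x) * D u x) x :=
      HasDerivAt.comp (h₂ := prim f) x (h.hasDerivAt_prim (hu.pos x hx).le) (hu.hasDerivAt hx)
    simp only [hpow]
    refine ((h1.const_mul ((p - 1) / p)).add (h3.const_mul lam)).congr_deriv ?_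
    rw [mul_assoc (p / (p - 1)), h2]
    field_simp
    ring
  exact (eq_left_of_hasDerivAt_zero hc hd hx).trans (eq_left_of_hasDerivAt_zero hc hd hy).symm

end IsPositiveSolution

/-! ### Shape and uniqueness of positive solutions -/

lemma speed_self {p : ℝ} (hp : 1 < p) (f : ℝ → ℝ) (lam M : ℝ) : speed p f lam M M = 0 := by
  rw [speed, sub_self, mul_zero, Real.zero_rpow (by positivity)]

namespace Admissible

variable {p q γ lam : ℝ} {f : ℝ → ℝ}

lemma speed_pos (h : Admissible p q γ f) (hlam : 0 < lam) {M s : ℝ} (hF : 0 ≤ prim f M)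
    (hs : 0 < s) (hsM : s < M) : 0 < speed p f lam M s := by
  have hp1 : 0 < p - 1 := by linarith [h.one_lt]
  have hp0 : 0 < p := by linarith
  have := sub_pos.2 (h.prim_lt hF hs hsM)
  exact Real.rpow_pos_of_pos (by positivity) _

/-- The integrand of the time map is the reciprocal of the speed, up to scaling. -/
lemma speed_mul_ker (h : Admissible p q γ f) (hlam : 0 < lam) {M t : ℝ} (hM : 0 < M)
    (hF : 0 ≤ prim f M) (ht : t ∈ Ioo 0 1) :
    speed p f lam M (M * t) / M * ker p f M t = (p / (p - 1) * lam) ^ (1 / p) := by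
  have hp1 : 0 < p - 1 := by linarith [h.one_lt]
  have hp0 : 0 < p := by linarith
  have hMp := Real.rpow_pos_of_pos hM p
  have hd := h.drop_pos hM hF ht
  have h1 : prim f M - prim f (M * t) = drop p f M t * M ^ p := by
    rw [drop]; field_simp
  have h2 : (M ^ p) ^ (1 / p) = M := by
    rw [← Real.rpow_mul hM.le, mul_one_div_cancel hp0.ne', Real.rpow_one]
  rw [speed, h1, Real.mul_rpow (by positivity) (by positivity), Real.mul_rpow hd.le hMp.le, h2,
    ker, Real.rpow_neg hd.le]
  have := Real.rpow_pos_of_pos hd (1 / p)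
  field_simp

end Admissible

namespace IsPositiveSolution

variable {p q γ lam : ℝ} {f u : ℝ → ℝ} {x₀ : ℝ}

lemma exists_max (hu : IsPositiveSolution p f lam u) :
    ∃ x₀ ∈ Ioo (-1 : ℝ) 1, ∀ x ∈ Icc (-1 : ℝ) 1, u x ≤ u x₀ := by
  obtain ⟨x₀, hx₀, hmax⟩ := isCompact_Icc.exists_isMaxOn (nonempty_Icc.2 (by norm_num))
    hu.continuousOn
  have h0 : 0 < u x₀ := (hu.pos 0 ⟨by norm_num, by norm_num⟩).trans_le
    (hmax ⟨by norm_num, by norm_num⟩)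
  refine ⟨x₀, ⟨lt_of_le_of_ne hx₀.1 ?_, lt_of_le_of_ne hx₀.2 ?_⟩, fun x hx => hmax hx⟩
  · rintro rfl
    exact h0.ne' hu.left
  · rintro rfl
    exact h0.ne' hu.right

lemma D_max (hu : IsPositiveSolution p f lam u) (hx₀ : x₀ ∈ Ioo (-1 : ℝ) 1)
    (hmax : ∀ x ∈ Icc (-1 : ℝ) 1, u x ≤ u x₀) : D u x₀ = 0 := by
  refine IsLocalMax.hasDerivAt_eq_zero ?_ (hu.hasDerivAt hx₀)
  filter_upwards [Icc_mem_nhds hx₀.1 hx₀.2] with x hx using hmax x hx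

/-- The energy identity, with the energy evaluated at the maximum point. -/
lemma energy_max (hu : IsPositiveSolution p f lam u) (h : Admissible p q γ f)
    (hx₀ : x₀ ∈ Ioo (-1 : ℝ) 1) (hmax : ∀ x ∈ Icc (-1 : ℝ) 1, u x ≤ u x₀) {x : ℝ}
    (hx : x ∈ Icc (-1 : ℝ) 1) :
    |D u x| ^ p = p / (p - 1) * lam * (prim f (u x₀) - prim f (u x)) := by
  have hp1 : 0 < p - 1 := by linarith [h.one_lt]
  have hp0 : 0 < p := by linarith
  have h1 := hu.energy h hx (Ioo_subset_Icc_self hx₀)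
  rw [hu.D_max hx₀ hmax, abs_zero, Real.zero_rpow hp0.ne'] at h1
  field_simp at h1 ⊢
  linarith

lemma prim_max_nonneg (hu : IsPositiveSolution p f lam u) (h : Admissible p q γ f)
    (hlam : 0 < lam) (hx₀ : x₀ ∈ Ioo (-1 : ℝ) 1) (hmax : ∀ x ∈ Icc (-1 : ℝ) 1, u x ≤ u x₀) :
    0 ≤ prim f (u x₀) := by
  have hp1 : 0 < p - 1 := by linarith [h.one_lt]
  have hp0 : 0 < p := by linarith
  have h1 := hu.energy_max h hx₀ hmax (x := 1) ⟨by norm_num, le_rfl⟩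
  rw [hu.right, prim_zero, sub_zero] at h1
  have h2 : 0 ≤ p / (p - 1) * lam * prim f (u x₀) := h1 ▸ Real.rpow_nonneg (abs_nonneg _) _
  exact nonneg_of_mul_nonneg_right h2 (by positivity)

lemma abs_D (hu : IsPositiveSolution p f lam u) (h : Admissible p q γ f)
    (hx₀ : x₀ ∈ Ioo (-1 : ℝ) 1) (hmax : ∀ x ∈ Icc (-1 : ℝ) 1, u x ≤ u x₀) {x : ℝ}
    (hx : x ∈ Icc (-1 : ℝ) 1) : |D u x| = speed p f lam (u x₀) (u x) := by
  have hp0 : 0 < p := by linarith [h.one_lt]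
  rw [speed, ← hu.energy_max h hx₀ hmax hx, ← Real.rpow_mul (abs_nonneg _),
    mul_one_div_cancel hp0.ne', Real.rpow_one]

/-- To the right of a maximum point a solution stays below its maximum. -/
lemma lt_max (hu : IsPositiveSolution p f lam u) (h : Admissible p q γ f)
    (hlam : 0 < lam) (hx₀ : x₀ ∈ Ioo (-1 : ℝ) 1) (hmax : ∀ x ∈ Icc (-1 : ℝ) 1, u x ≤ u x₀)
    {x : ℝ} (hx : x ∈ Ioo x₀ 1) : u x < u x₀ := by
  have hF := hu.prim_max_nonneg h hlam hx₀ hmax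
  have hM : 0 < u x₀ := hu.pos x₀ hx₀
  by_contra! hge
  have hsub : Icc x₀ x ⊆ Ioo (-1 : ℝ) 1 := fun y hy => ⟨hx₀.1.trans_le hy.1, hy.2.trans_lt hx.2⟩
  -- Between two maximum points there is no lower critical point, so the solution is constant.
  have hconst : ∀ y ∈ Icc x₀ x, u y = u x₀ := by
    obtain ⟨y, hy, hmin⟩ := isCompact_Icc.exists_isMinOn (nonempty_Icc.2 hx.1.le)
      (hu.continuousOn.mono (hsub.trans Ioo_subset_Icc_self))
    have hyM : u y = u x₀ := by
      by_contra hne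
      have hlt : u y < u x₀ := lt_of_le_of_ne (hmax y (Ioo_subset_Icc_self (hsub hy))) hne
      have hy0 : y ≠ x₀ := fun h0 => hne (by rw [h0])
      have hy1 : y ≠ x := fun h0 => by rw [h0] at hlt; linarith
      have hyI : y ∈ Ioo x₀ x :=
        ⟨lt_of_le_of_ne hy.1 (Ne.symm hy0), lt_of_le_of_ne hy.2 hy1⟩
      have hD : D u y = 0 := by
        refine IsLocalMin.hasDerivAt_eq_zero ?_ (hu.hasDerivAt (hsub hy))
        filter_upwards [Icc_mem_nhds hyI.1 hyI.2] with z hz using hmin hz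
      have h1 := hu.abs_D h hx₀ hmax (Ioo_subset_Icc_self (hsub hy))
      rw [hD, abs_zero] at h1
      exact (h.speed_pos hlam hF (hu.pos y (hsub hy)) hlt).ne h1
    intro z hz
    exact le_antisymm (hmax z (Ioo_subset_Icc_self (hsub hz))) (hyM ▸ hmin hz)
  obtain ⟨m, hm⟩ := exists_between hx.1
  have hev : (fun y => phi p (D u y)) =ᶠ[𝓝 m] fun _ => 0 := by
    filter_upwards [Icc_mem_nhds hm.1 hm.2] with y hy
    have h1 := hu.abs_D h hx₀ hmax (Ioo_subset_Icc_self (hsub hy))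
    rw [hconst y hy, speed_self h.one_lt, abs_eq_zero] at h1
    rw [h1, phi_zero]
  have hmI : m ∈ Icc x₀ x := ⟨hm.1.le, hm.2.le⟩
  have h2 := (hu.equation m (hsub hmI)).unique
    ((hasDerivAt_const m (0 : ℝ)).congr_of_eventuallyEq hev)
  rw [hconst m hmI] at h2
  have h3 := mul_pos hlam (h.pos _ (h.gamma_lt hM hF))
  linarith

lemma D_eq_neg_speed (hu : IsPositiveSolution p f lam u) (h : Admissible p q γ f)
    (hlam : 0 < lam) (hx₀ : x₀ ∈ Ioo (-1 : ℝ) 1) (hmax : ∀ x ∈ Icc (-1 : ℝ) 1, u x ≤ u x₀)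
    {x : ℝ} (hx : x ∈ Ioo x₀ 1) : D u x = -speed p f lam (u x₀) (u x) := by
  have hF := hu.prim_max_nonneg h hlam hx₀ hmax
  have hM : 0 < u x₀ := hu.pos x₀ hx₀
  have hsub : Ioo x₀ 1 ⊆ Ioo (-1 : ℝ) 1 := Ioo_subset_Ioo_left hx₀.1.le
  have hne : ∀ y ∈ Ioo x₀ 1, D u y ≠ 0 := fun y hy h0 => by
    have h1 := hu.abs_D h hx₀ hmax (Ioo_subset_Icc_self (hsub hy))
    rw [h0, abs_zero] at h1
    exact (h.speed_pos hlam hF (hu.pos y (hsub hy)) (hu.lt_max h hlam hx₀ hmax hy)).ne h1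
  obtain ⟨c, hc, hs⟩ := exists_hasDerivAt_eq_slope u (D u) hx₀.2
    (hu.continuousOn.mono (Icc_subset_Icc_left hx₀.1.le)) fun y hy => hu.hasDerivAt (hsub hy)
  have hDc : D u c < 0 := by
    rw [hs, hu.right]
    exact div_neg_of_neg_of_pos (by linarith) (by linarith [hx₀.2])
  have hD : D u x < 0 := by
    by_contra! hge
    have hpre : IsPreconnected (D u '' Ioo x₀ 1) :=
      isPreconnected_Ioo.image _ (hu.continuousOn_D.mono (hsub.trans Ioo_subset_Icc_self))
    obtain ⟨y, hy, hy0⟩ := hpre.ordConnected.out (mem_image_of_mem _ hc) (mem_image_of_mem _ hx)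
      (⟨hDc.le, hge⟩ : (0 : ℝ) ∈ Icc (D u c) (D u x))
    exact hne y hy hy0
  have h1 := hu.abs_D h hx₀ hmax (Ioo_subset_Icc_self (hsub hx))
  rw [abs_of_neg hD] at h1
  linarith

/-- The substitution `t = u(x) / M` on the right of the maximum point turns the time map into
the distance travelled. In particular the time map converges. -/
lemma tail_right (hu : IsPositiveSolution p f lam u) (h : Admissible p q γ f)
    (hlam : 0 < lam) (hx₀ : x₀ ∈ Ioo (-1 : ℝ) 1) (hmax : ∀ x ∈ Icc (-1 : ℝ) 1, u x ≤ u x₀) :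
    u x₀ ∈ amplitudes p f ∧ ∀ x ∈ Icc x₀ 1,
      tail p f (u x₀) (u x / u x₀) = (p / (p - 1) * lam) ^ (1 / p) * (x - x₀) := by
  have hF := hu.prim_max_nonneg h hlam hx₀ hmax
  set M := u x₀ with hMdef
  have hM : 0 < M := hu.pos x₀ hx₀
  have hsub : Ioo x₀ 1 ⊆ Ioo (-1 : ℝ) 1 := Ioo_subset_Ioo_left hx₀.1.le
  have hanti : StrictAntiOn (fun x => u x / M) (Icc x₀ 1) := by
    have h1 : StrictAntiOn u (Icc x₀ 1) := by
      refine strictAntiOn_of_deriv_neg (convex_Icc _ _)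
        (hu.continuousOn.mono (Icc_subset_Icc_left hx₀.1.le)) fun y hy => ?_
      rw [interior_Icc] at hy
      rw [(hu.hasDerivAt (hsub hy)).deriv, hu.D_eq_neg_speed h hlam hx₀ hmax hy]
      exact neg_neg_of_pos
        (h.speed_pos hlam hF (hu.pos y (hsub hy)) (hu.lt_max h hlam hx₀ hmax hy))
    exact fun a ha b hb hab => div_lt_div_of_pos_right (h1 ha hb hab) hM
  have hcont : ContinuousOn (fun x => u x / M) (Icc x₀ 1) :=
    (hu.continuousOn.mono (Icc_subset_Icc_left hx₀.1.le)).div_const M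
  have himage : ∀ x ∈ Icc x₀ 1, (fun x => u x / M) '' Ioo x₀ x = Ioo (u x / M) 1 := by
    intro x hx
    have hx₀1 : u x₀ / M = 1 := div_self hM.ne'
    apply Subset.antisymm
    · rintro _ ⟨y, hy, rfl⟩
      have hyI : y ∈ Icc x₀ 1 := ⟨hy.1.le, hy.2.le.trans hx.2⟩
      refine ⟨hanti hyI hx hy.2, ?_⟩
      rw [← hx₀1]
      exact hanti ⟨le_rfl, hx₀.2.le⟩ hyI hy.1
    · rw [← hx₀1]
      exact intermediate_value_Ioo' hx.1 (hcont.mono (Icc_subset_Icc_right hx.2))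
  have hderiv : ∀ x ∈ Icc x₀ 1, ∀ y ∈ Ioo x₀ x,
      HasDerivWithinAt (fun x => u x / M) (D u y / M) (Ioo x₀ x) y := fun x hx y hy =>
    ((hu.hasDerivAt (hsub ⟨hy.1, hy.2.trans_le hx.2⟩)).div_const M).hasDerivWithinAt
  have hinj : ∀ x ∈ Icc x₀ 1, InjOn (fun x => u x / M) (Ioo x₀ x) := fun x hx =>
    hanti.injOn.mono (Ioo_subset_Icc_self.trans (Icc_subset_Icc_right hx.2))
  have hint : ∀ x ∈ Icc x₀ 1, EqOn (fun y => |D u y / M| • ker p f M (u y / M))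
      (fun _ => (p / (p - 1) * lam) ^ (1 / p)) (Ioo x₀ x) := by
    intro x hx y hy
    have hy1 : y ∈ Ioo x₀ 1 := ⟨hy.1, hy.2.trans_le hx.2⟩
    have hlt := hu.lt_max h hlam hx₀ hmax hy1
    have h1 := h.speed_mul_ker hlam hM hF (t := u y / M)
      ⟨div_pos (hu.pos y (hsub hy1)) hM, (div_lt_one hM).2 hlt⟩
    rw [mul_div_cancel₀ _ hM.ne'] at h1
    simp only [smul_eq_mul]
    rw [abs_div, abs_of_pos hM, hu.abs_D h hx₀ hmax (Ioo_subset_Icc_self (hsub hy1))]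
    exact h1
  have h1mem : (1 : ℝ) ∈ Icc x₀ 1 := ⟨hx₀.2.le, le_rfl⟩
  refine ⟨⟨hM, hF, ?_⟩, fun x hx => ?_⟩
  · have himg := himage 1 h1mem
    rw [hu.right, zero_div] at himg
    rw [← himg, integrableOn_image_iff_integrableOn_abs_deriv_smul measurableSet_Ioo
      (hderiv 1 h1mem) (hinj 1 h1mem), integrableOn_congr_fun (hint 1 h1mem) measurableSet_Ioo]
    exact integrableOn_const (by simp)
  · rw [tail, ← himage x hx, integral_image_eq_integral_abs_deriv_smul measurableSet_Ioo
      (hderiv x hx) (hinj x hx), setIntegral_congr_fun measurableSet_Ioo (hint x hx),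
      setIntegral_const]
    simp [hx.1, mul_comm]

/-- The maximum is attained at the origin. -/
lemma le_apply_zero (hu : IsPositiveSolution p f lam u) (h : Admissible p q γ f)
    (hlam : 0 < lam) : ∀ x ∈ Icc (-1 : ℝ) 1, u x ≤ u 0 := by
  obtain ⟨x₀, hx₀, hmax⟩ := hu.exists_max
  have h1 := (hu.tail_right h hlam hx₀ hmax).2 1 ⟨hx₀.2.le, le_rfl⟩
  have hx₀' : -x₀ ∈ Ioo (-1 : ℝ) 1 := ⟨by linarith [hx₀.2], by linarith [hx₀.1]⟩
  have hmax' : ∀ x ∈ Icc (-1 : ℝ) 1, u (-x) ≤ u (- -x₀) := fun x hx => by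
    rw [neg_neg]
    exact hmax (-x) ⟨by linarith [hx.2], by linarith [hx.1]⟩
  have h2 := (hu.comp_neg.tail_right h hlam hx₀' hmax').2 1 ⟨hx₀'.2.le, le_rfl⟩
  simp only [neg_neg, hu.left, hu.right, zero_div] at h1 h2
  have hp1 : 0 < p - 1 := by linarith [h.one_lt]
  have hp0 : 0 < p := by linarith
  have hpos : 0 < (p / (p - 1) * lam) ^ (1 / p) := Real.rpow_pos_of_pos (by positivity) _
  have h3 := mul_left_cancel₀ hpos.ne' (h1.symm.trans h2)
  have : x₀ = 0 := by linarith
  rwa [this] at hmax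

lemma apply_zero_mem (hu : IsPositiveSolution p f lam u) (h : Admissible p q γ f)
    (hlam : 0 < lam) : u 0 ∈ amplitudes p f :=
  (hu.tail_right h hlam ⟨by norm_num, by norm_num⟩ (hu.le_apply_zero h hlam)).1

/-- A positive solution is determined by its maximum: its inverse is a partial time map. -/
lemma tail_eq (hu : IsPositiveSolution p f lam u) (h : Admissible p q γ f) (hlam : 0 < lam)
    {x : ℝ} (hx : x ∈ Icc (-1 : ℝ) 1) :
    tail p f (u 0) (u x / u 0) = (p / (p - 1) * lam) ^ (1 / p) * |x| := by
  have h0 : (0 : ℝ) ∈ Ioo (-1 : ℝ) 1 := ⟨by norm_num, by norm_num⟩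
  have hmax := hu.le_apply_zero h hlam
  rcases le_total 0 x with hx0 | hx0
  · have := (hu.tail_right h hlam h0 hmax).2 x ⟨hx0, hx.2⟩
    simpa [abs_of_nonneg hx0] using this
  · have := (hu.comp_neg.tail_right h hlam h0 (fun y hy => by
      rw [neg_zero]; exact hmax (-y) ⟨by linarith [hy.2], by linarith [hy.1]⟩)).2 (-x)
      ⟨by linarith, by linarith [hx.1]⟩
    simpa [abs_of_nonpos hx0] using this

lemma timeMap_eq (hu : IsPositiveSolution p f lam u) (h : Admissible p q γ f) (hlam : 0 < lam) :
    tail p f (u 0) 0 = (p / (p - 1) * lam) ^ (1 / p) := by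
  have := hu.tail_eq h hlam (x := 1) ⟨by norm_num, le_rfl⟩
  simpa [hu.right] using this

lemma div_mem (hu : IsPositiveSolution p f lam u) (h : Admissible p q γ f) (hlam : 0 < lam)
    {x : ℝ} (hx : x ∈ Icc (-1 : ℝ) 1) : u x / u 0 ∈ Icc (0 : ℝ) 1 := by
  have hM := (hu.apply_zero_mem h hlam).1
  exact ⟨div_nonneg (hu.nonneg hx) hM.le, (div_le_one hM).2 (hu.le_apply_zero h hlam x hx)⟩

lemma even (hu : IsPositiveSolution p f lam u) (h : Admissible p q γ f) (hlam : 0 < lam)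
    {x : ℝ} (hx : x ∈ Icc (-1 : ℝ) 1) : u (-x) = u x := by
  have hx' : -x ∈ Icc (-1 : ℝ) 1 := ⟨by linarith [hx.2], by linarith [hx.1]⟩
  have hA := hu.apply_zero_mem h hlam
  have h1 := (h.strictAntiOn_tail hA).injOn (hu.div_mem h hlam hx') (hu.div_mem h hlam hx)
    (by rw [hu.tail_eq h hlam hx', hu.tail_eq h hlam hx, abs_neg])
  field_simp [hA.1.ne'] at h1
  exact h1

lemma D_of_mem_Icc (hu : IsPositiveSolution p f lam u) (h : Admissible p q γ f) (hlam : 0 < lam)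
    {x : ℝ} (hx : x ∈ Icc (0 : ℝ) 1) : D u x = -speed p f lam (u 0) (u x) := by
  have h0 : (0 : ℝ) ∈ Ioo (-1 : ℝ) 1 := ⟨by norm_num, by norm_num⟩
  have hmax := hu.le_apply_zero h hlam
  rcases hx.1.eq_or_lt with rfl | hx0
  · rw [hu.D_max h0 hmax, speed_self h.one_lt, neg_zero]
  rcases hx.2.eq_or_lt with rfl | hx1
  -- At the end point the sign of the derivative is inherited by continuity.
  · have habs := hu.abs_D h h0 hmax (x := 1) ⟨by norm_num, le_rfl⟩
    have hle : D u 1 ≤ 0 := by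
      have hc : Tendsto (D u) (𝓝[<] 1) (𝓝 (D u 1)) :=
        (hu.continuousOn_D 1 ⟨by norm_num, le_rfl⟩).mono_of_mem_nhdsWithin
          (Icc_mem_nhdsLT (by norm_num))
      refine le_of_tendsto hc ?_
      filter_upwards [Ioo_mem_nhdsLT (zero_lt_one' ℝ)] with y hy
      rw [hu.D_eq_neg_speed h hlam h0 hmax hy]
      exact neg_nonpos.2 (h.speed_pos hlam (hu.prim_max_nonneg h hlam h0 hmax)
        (hu.pos y ⟨by linarith [hy.1], hy.2⟩) (hu.lt_max h hlam h0 hmax hy)).le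
    rw [abs_of_nonpos hle] at habs
    linarith
  · exact hu.D_eq_neg_speed h hlam h0 hmax ⟨hx0, hx1⟩

lemma D_neg (hu : IsPositiveSolution p f lam u) (h : Admissible p q γ f) (hlam : 0 < lam)
    {x : ℝ} (hx : x ∈ Icc (-1 : ℝ) 1) : D u (-x) = -D u x := by
  have h1 : D (fun y => u (-y)) x = D u x :=
    derivWithin_congr (fun y hy => hu.even h hlam hy) (hu.even h hlam hx)
  rw [D_comp_neg] at h1
  linarith

lemma D_neg_of_pos (hu : IsPositiveSolution p f lam u) (h : Admissible p q γ f) (hlam : 0 < lam)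
    {x : ℝ} (hx : x ∈ Ioo (0 : ℝ) 1) : D u x < 0 := by
  have h0 : (0 : ℝ) ∈ Ioo (-1 : ℝ) 1 := ⟨by norm_num, by norm_num⟩
  have hmax := hu.le_apply_zero h hlam
  rw [hu.D_of_mem_Icc h hlam (Ioo_subset_Icc_self hx)]
  exact neg_neg_of_pos (h.speed_pos hlam (hu.prim_max_nonneg h hlam h0 hmax)
    (hu.pos x ⟨by linarith [hx.1], hx.2⟩) (hu.lt_max h hlam h0 hmax hx))

/-- Uniqueness: the parameter determines the maximum through the time map, and the maximum
determines the solution. -/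
lemma eqOn {v : ℝ → ℝ} (hu : IsPositiveSolution p f lam u) (hv : IsPositiveSolution p f lam v)
    (h : Admissible p q γ f) (hlam : 0 < lam) : EqOn u v (Icc (-1) 1) := by
  have hA := hu.apply_zero_mem h hlam
  have h0 : u 0 = v 0 := h.strictAntiOn_timeMap.injOn hA (hv.apply_zero_mem h hlam)
    ((hu.timeMap_eq h hlam).trans (hv.timeMap_eq h hlam).symm)
  intro x hx
  have hvm := hv.div_mem h hlam hx
  have hvt := hv.tail_eq h hlam hx
  rw [← h0] at hvm hvt
  have h1 := (h.strictAntiOn_tail hA).injOn (hu.div_mem h hlam hx) hvm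
    ((hu.tail_eq h hlam hx).trans hvt.symm)
  exact (div_left_inj' hA.1.ne').1 h1

end IsPositiveSolution

/-! ### Existence -/

lemma continuous_phi {p : ℝ} (hp : 1 < p) : Continuous (phi p) := by
  refine continuous_iff_continuousAt.2 fun t => ?_
  rcases eq_or_ne t 0 with rfl | ht
  · rw [ContinuousAt, phi_zero, tendsto_zero_iff_abs_tendsto_zero]
    have h1 : Continuous fun t : ℝ => |t| ^ (p - 1) :=
      continuous_abs.rpow_const fun _ => Or.inr (sub_pos.2 hp).le
    have h2 := h1.tendsto 0
    rw [abs_zero, Real.zero_rpow (sub_pos.2 hp).ne'] at h2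
    exact h2.congr fun t => (abs_phi hp t).symm
  · exact (hasDerivAt_phi p ht).continuousAt

/-- A continuous function on `[-1, 1]` whose derivative off the origin extends continuously to
the line is a primitive of that extension. -/
lemma eq_primitive_of_hasDerivAt_off_zero {k e : ℝ → ℝ} (hk : Continuous k) (he : Continuous e)
    (hd : ∀ x ∈ Ioo (-1 : ℝ) 1, x ≠ 0 → HasDerivAt k (e x) x) {x : ℝ} (hx : x ∈ Icc (-1 : ℝ) 1) :
    k x = k 0 + ∫ y in (0 : ℝ)..x, e y := by
  rw [integral_eq_of_hasDerivAt_off_countable k e (countable_singleton (0 : ℝ)) hk.continuousOn _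
    (he.intervalIntegrable _ _)]
  · ring
  · rintro y ⟨hy, hy0⟩
    refine hd y ⟨lt_of_le_of_lt ?_ hy.1, lt_of_lt_of_le hy.2 ?_⟩ hy0
    · exact le_min (by norm_num) hx.1
    · exact max_le (by norm_num) hx.2

lemma hasDerivAt_primitive {e : ℝ → ℝ} (he : Continuous e) (c x : ℝ) :
    HasDerivAt (fun x => c + ∫ y in (0 : ℝ)..x, e y) (e x) x :=
  ((he.integral_hasStrictDerivAt 0 x).hasDerivAt).const_add c

namespace Admissible

variable {p q γ lam : ℝ} {f : ℝ → ℝ}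

/-- The inverse of the partial time map, scaled to the interval `[-1, 1]` and reflected. -/
lemma exists_inverse_tail (h : Admissible p q γ f) {M : ℝ} (hM : M ∈ amplitudes p f) :
    ∃ u : ℝ → ℝ, Continuous u ∧ (∀ x, u x / M ∈ Icc (0 : ℝ) 1) ∧ (∀ x, u (-x) = u x) ∧
      ∀ x ∈ Icc (-1 : ℝ) 1, tail p f M (u x / M) = tail p f M 0 * |x| := by
  have hT := h.tail_zero_pos hM
  let R : Icc (0 : ℝ) 1 → ℝ := fun t => tail p f M t
  have hRc : Continuous R := continuousOn_iff_continuous_domRestrict.1 (continuousOn_tail hM)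
  have hRi : Function.Injective R := fun s t hst =>
    Subtype.ext ((h.strictAntiOn_tail hM).injOn s.2 t.2 hst)
  have hRe := (hRc.isClosedEmbedding hRi).isEmbedding
  have hsurj : ∀ y : Icc (0 : ℝ) (tail p f M 0), ∃ t, R t = y := by
    rintro ⟨y, hy⟩
    obtain ⟨t, ht, hty⟩ := intermediate_value_Icc' zero_le_one (continuousOn_tail hM)
      (by rwa [tail_one] : y ∈ Icc (tail p f M 1) (tail p f M 0))
    exact ⟨⟨t, ht⟩, hty⟩
  choose Z hZ using hsurj
  have hZc : Continuous Z := by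
    rw [hRe.continuous_iff]
    have : R ∘ Z = Subtype.val := funext hZ
    rw [this]
    exact continuous_subtype_val
  have hdiv : ∀ y, M * (Z y : ℝ) / M = Z y := fun y => mul_div_cancel_left₀ _ hM.1.ne'
  refine ⟨fun x => M * (Z (projIcc 0 (tail p f M 0) hT.le (tail p f M 0 * |x|)) : ℝ),
    ?_, fun x => ?_, fun x => by simp only [abs_neg], fun x hx => ?_⟩
  · have := continuous_projIcc (h := hT.le)
    fun_prop
  · simp only [hdiv]
    exact Subtype.coe_prop _
  · simp only [hdiv]
    have h1 : tail p f M 0 * |x| ∈ Icc 0 (tail p f M 0) :=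
      ⟨by positivity, mul_le_of_le_one_right hT.le (abs_le.2 hx)⟩
    rw [projIcc_of_mem _ h1]
    exact hZ _

/-- Existence: every admissible amplitude is the maximum of a positive solution, for the value of
the parameter that the time map prescribes. -/
lemma exists_solution (h : Admissible p q γ f) (hlam : 0 < lam) {M : ℝ}
    (hM : M ∈ amplitudes p f) (hT : tail p f M 0 = (p / (p - 1) * lam) ^ (1 / p)) :
    ∃ u, IsPositiveSolution p f lam u ∧ u 0 = M := by
  obtain ⟨u, huc, hum, heven, htail⟩ := h.exists_inverse_tail hM
  have hp1 : 0 < p - 1 := by linarith [h.one_lt]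
  have hp0 : 0 < p := by linarith
  have hM0 := hM.1
  have hTpos := h.tail_zero_pos hM
  have hinj := (h.strictAntiOn_tail hM).injOn
  have hu1 : u 1 = 0 := by
    have h1 := htail 1 ⟨by norm_num, le_rfl⟩
    rw [abs_one, mul_one] at h1
    simpa [hM0.ne'] using hinj (hum 1) ⟨le_rfl, zero_le_one⟩ h1
  have hu0 : u 0 = M := by
    have h1 := htail 0 ⟨by norm_num, by norm_num⟩
    rw [abs_zero, mul_zero] at h1
    exact (div_eq_one_iff_eq hM0.ne').1
      (hinj (hum 0) ⟨zero_le_one, le_rfl⟩ (h1.trans (tail_one p f M).symm))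
  have hunn : ∀ x, 0 ≤ u x := fun x => by
    have := mul_nonneg (hum x).1 hM0.le
    rwa [div_mul_cancel₀ _ hM0.ne'] at this
  have hpos : ∀ x ∈ Ioo (-1 : ℝ) 1, 0 < u x := by
    intro x hx
    refine lt_of_le_of_ne (hunn x) fun h0 => ?_
    have h1 := htail x (Ioo_subset_Icc_self hx)
    rw [← h0, zero_div] at h1
    have h2 : |x| < 1 := abs_lt.2 hx
    nlinarith
  have hlt : ∀ x ∈ Ioo (0 : ℝ) 1, u x / M ∈ Ioo (0 : ℝ) 1 := by
    intro x hx
    have hx' : x ∈ Ioo (-1 : ℝ) 1 := ⟨by linarith [hx.1], hx.2⟩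
    refine ⟨div_pos (hpos x hx') hM0, lt_of_le_of_ne (hum x).2 fun h1 => ?_⟩
    have h2 := htail x (Ioo_subset_Icc_self hx')
    rw [h1, tail_one, abs_of_pos hx.1] at h2
    have := mul_pos hTpos hx.1
    linarith
  have hgap : ∀ x ∈ Ioo (0 : ℝ) 1, 0 < prim f M - prim f (u x) := fun x hx =>
    sub_pos.2 (h.prim_lt hM.2.1 (hpos x ⟨by linarith [hx.1], hx.2⟩)
      ((div_lt_one hM0).1 (hlt x hx).2))
  -- The derivative, by the inverse function theorem.
  let d : ℝ → ℝ := fun x => if x ≤ 0 then speed p f lam M (u x) else -speed p f lam M (u x)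
  have hspc : Continuous fun x => speed p f lam M (u x) := by
    refine Continuous.rpow_const ?_ fun _ => Or.inr (by positivity)
    have := h.continuous_prim
    fun_prop
  have hdc : Continuous d := by
    refine Continuous.if_le hspc hspc.neg continuous_id continuous_const fun x hx => ?_
    rw [show x = 0 from hx, hu0, speed_self h.one_lt, neg_zero]
  have hdpos : ∀ x, 0 < x → d x = -speed p f lam M (u x) := fun x hx => if_neg hx.not_ge
  have hdodd : ∀ x, d (-x) = -d x := by
    intro x
    rcases lt_trichotomy x 0 with hx | rfl | hx
    · simp only [d]
      rw [if_neg (by linarith), if_pos hx.le, heven]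
    · simp [d, hu0, speed_self h.one_lt]
    · simp only [d]
      rw [if_pos (by linarith), if_neg (by linarith), heven, neg_neg]
  have hderpos : ∀ x ∈ Ioo (0 : ℝ) 1, HasDerivAt u (d x) x := by
    intro x hx
    have ht := hlt x hx
    have h1 : HasDerivAt (fun t => tail p f M t / tail p f M 0)
        (-ker p f M (u x / M) / tail p f M 0) (u x / M) :=
      (h.hasDerivAt_tail hM ht).div_const _
    have hk := h.ker_pos hM0 hM.2.1 ht
    have h2 : HasDerivAt (fun x => u x / M) (-ker p f M (u x / M) / tail p f M 0)⁻¹ x := by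
      refine HasDerivAt.of_local_left_inverse (f := fun t => tail p f M t / tail p f M 0)
        (g := fun x => u x / M) (huc.div_const M).continuousAt h1
        (div_ne_zero (neg_ne_zero.2 hk.ne') hTpos.ne') ?_
      filter_upwards [Ioo_mem_nhds hx.1 hx.2] with y hy
      rw [htail y ⟨by linarith [hy.1], hy.2.le⟩, abs_of_pos hy.1, mul_div_cancel_left₀ _ hTpos.ne']
    have h3 := h2.const_mul M
    have h4 : (fun x => M * (u x / M)) = u := funext fun y => mul_div_cancel₀ _ hM0.ne'
    rw [h4] at h3
    refine h3.congr_deriv ?_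
    have h5 := h.speed_mul_ker hlam hM0 hM.2.1 ht
    rw [mul_div_cancel₀ _ hM0.ne', ← hT] at h5
    rw [hdpos x hx.1]
    field_simp at h5 ⊢
    linarith
  have hder : ∀ x ∈ Ioo (-1 : ℝ) 1, x ≠ 0 → HasDerivAt u (d x) x := by
    intro x hx hx0
    rcases lt_or_gt_of_ne hx0 with hneg | hpos
    · have h1 := (hderpos (-x) ⟨by linarith, by linarith [hx.1]⟩).comp x (hasDerivAt_neg x)
      have h2 : u ∘ Neg.neg = u := funext heven
      rw [h2, hdodd] at h1
      simpa using h1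
    · exact hderpos x ⟨hpos, hx.2⟩
  have hprim : ∀ x ∈ Icc (-1 : ℝ) 1, u x = u 0 + ∫ y in (0 : ℝ)..x, d y := fun x hx =>
    eq_primitive_of_hasDerivAt_off_zero huc hdc hder hx
  have hD : ∀ x ∈ Icc (-1 : ℝ) 1, D u x = d x := fun x hx =>
    (((hasDerivAt_primitive hdc (u 0) x).hasDerivWithinAt.congr hprim
      (hprim x hx)).derivWithin (uniqueDiffOn_Icc (by norm_num) x hx))
  -- The flux, by the chain rule off the origin.
  have hfc : Continuous fun x => -(lam * f (u x)) :=
    (continuous_const.mul (h.contDiffOn.continuousOn.comp_continuous huc hunn)).neg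
  have hfluxpos : ∀ x ∈ Ioo (0 : ℝ) 1,
      HasDerivAt (fun y => phi p (d y)) (-(lam * f (u x))) x := by
    intro x hx
    have hg := hgap x hx
    have h1 : HasDerivAt (fun y => p / (p - 1) * lam * (prim f M - prim f (u y)))
        (p / (p - 1) * lam * -(f (u x) * d x)) x := by
      have h2 : HasDerivAt (fun y => prim f (u y)) (f (u x) * d x) x :=
        HasDerivAt.comp (h₂ := prim f) x (h.hasDerivAt_prim (hunn x)) (hderpos x hx)
      exact (h2.const_sub _).const_mul _
    have h2 := (h1.rpow_const (p := (p - 1) / p) (Or.inl (by positivity))).neg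
    have hev : (fun y => phi p (d y)) =ᶠ[𝓝 x]
        fun y => -(p / (p - 1) * lam * (prim f M - prim f (u y))) ^ ((p - 1) / p) := by
      filter_upwards [Ioo_mem_nhds hx.1 hx.2] with y hy
      have hg' := hgap y hy
      rw [hdpos y hy.1, phi_neg, speed,
        phi_of_nonneg h.one_lt (Real.rpow_nonneg (by positivity) _),
        ← Real.rpow_mul (by positivity)]
      congr 2
      field_simp
    refine (h2.congr_of_eventuallyEq hev).congr_deriv ?_
    have hA : 0 < p / (p - 1) * lam * (prim f M - prim f (u x)) := by positivity
    rw [hdpos x hx.1, speed, show (p - 1) / p - 1 = -(1 / p) by field_simp; ring,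
      Real.rpow_neg hA.le]
    have := Real.rpow_pos_of_pos hA (1 / p)
    field_simp
  have hflux : ∀ x ∈ Ioo (-1 : ℝ) 1, x ≠ 0 →
      HasDerivAt (fun y => phi p (d y)) (-(lam * f (u x))) x := by
    intro x hx hx0
    rcases lt_or_gt_of_ne hx0 with hneg | hpos
    · have h1 := ((hfluxpos (-x) ⟨by linarith, by linarith [hx.1]⟩).comp x (hasDerivAt_neg x)).neg
      have h2 : -((fun y => phi p (d y)) ∘ Neg.neg) = fun y => phi p (d y) := by
        funext y
        simp [hdodd, phi_neg]
      rw [h2, heven] at h1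
      simpa using h1
    · exact hfluxpos x ⟨hpos, hx.2⟩
  refine ⟨u, ⟨?_, fun x hx => ?_, ?_, hu1, hpos⟩, hu0⟩
  · have hC : ContDiff ℝ 1 fun x => u 0 + ∫ y in (0 : ℝ)..x, d y := by
      refine contDiff_one_iff_deriv.2
        ⟨fun x => (hasDerivAt_primitive hdc (u 0) x).differentiableAt, ?_⟩
      have : deriv (fun x => u 0 + ∫ y in (0 : ℝ)..x, d y) = d :=
        funext fun x => (hasDerivAt_primitive hdc (u 0) x).deriv
      rwa [this]
    exact hC.contDiffOn.congr hprim
  · refine (hasDerivAt_primitive hfc (phi p (d 0)) x).congr_of_eventuallyEq ?_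
    filter_upwards [Icc_mem_nhds hx.1 hx.2] with y hy
    rw [hD y hy]
    exact eq_primitive_of_hasDerivAt_off_zero ((continuous_phi h.one_lt).comp hdc) hfc hflux hy
  · rw [heven, hu1]

end Admissible

/-! ### Non-degeneracy -/

/-- A solution `w` of the linearized problem together with its flux `v`. -/
structure IsLinearizedPair (p : ℝ) (f : ℝ → ℝ) (lam : ℝ) (u w v : ℝ → ℝ) : Prop where
  continuousOn : ContinuousOn w (Icc (-1) 1)
  left : w (-1) = 0
  right : w 1 = 0
  flux : ∀ x ∈ Ioo (-1 : ℝ) 1, D u x ≠ 0 →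
    DifferentiableAt ℝ w x ∧ v x = deriv (phi p) (D u x) * deriv w x
  equation : ∀ x ∈ Ioo (-1 : ℝ) 1, HasDerivAt v (-(lam * deriv f (u x) * w x)) x

lemma IsLinearizedSolution.exists_pair {p lam : ℝ} {f u w : ℝ → ℝ}
    (hw : IsLinearizedSolution p f lam u w) : ∃ v, IsLinearizedPair p f lam u w v := by
  obtain ⟨v, h1, h2⟩ := hw.equation
  exact ⟨v, hw.continuousOn, hw.left, hw.right, h1, h2⟩

lemma IsPositiveSolution.exists_hasDerivAt_D {p lam : ℝ} {f u : ℝ → ℝ} (hp : 1 < p)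
    (hu : IsPositiveSolution p f lam u) {x : ℝ} (hx : x ∈ Ioo (-1 : ℝ) 1) (hD : D u x ≠ 0) :
    ∃ s, HasDerivAt (D u) s x ∧ deriv (phi p) (D u x) * s = -(lam * f (u x)) := by
  have h1 := (hasDerivAt_phi (p / (p - 1)) (phi_ne_zero (p := p) hD)).comp x (hu.equation x hx)
  have h2 : phi (p / (p - 1)) ∘ (fun y => phi p (D u y)) = D u :=
    funext fun y => phi_conj_phi hp (D u y)
  rw [h2] at h1
  refine ⟨_, h1, ?_⟩
  have h3 : HasDerivAt (fun y => phi p (D u y)) _ x :=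
    HasDerivAt.comp (h₂ := phi p) x (hasDerivAt_phi p hD).differentiableAt.hasDerivAt h1
  exact h3.unique (hu.equation x hx)

namespace IsLinearizedPair

variable {p q γ lam : ℝ} {f u w v : ℝ → ℝ}

lemma neg (hw : IsLinearizedPair p f lam u w v) :
    IsLinearizedPair p f lam u (fun x => -w x) fun x => -v x where
  continuousOn := hw.continuousOn.neg
  left := by simp [hw.left]
  right := by simp [hw.right]
  flux x hx hD := by
    obtain ⟨h1, h2⟩ := hw.flux x hx hD
    refine ⟨h1.neg, ?_⟩
    rw [h1.hasDerivAt.fun_neg.deriv, h2]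
    ring
  equation x hx := (hw.equation x hx).neg.congr_deriv (by ring)

lemma comp_neg (hw : IsLinearizedPair p f lam u w v) (hu : IsPositiveSolution p f lam u)
    (h : Admissible p q γ f) (hlam : 0 < lam) :
    IsLinearizedPair p f lam u (fun x => w (-x)) fun x => -v (-x) where
  continuousOn := hw.continuousOn.comp continuous_neg.continuousOn fun x hx => by
    exact ⟨by linarith [hx.2], by linarith [hx.1]⟩
  left := by simpa using hw.right
  right := hw.left
  flux x hx hD := by
    have hx' : -x ∈ Ioo (-1 : ℝ) 1 := ⟨by linarith [hx.2], by linarith [hx.1]⟩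
    have hDn := hu.D_neg h hlam (Ioo_subset_Icc_self hx)
    obtain ⟨h1, h2⟩ := hw.flux (-x) hx' (by rw [hDn]; exact neg_ne_zero.2 hD)
    have h3 : HasDerivAt (fun x => w (-x)) (deriv w (-x) * -1) x :=
      HasDerivAt.comp (h₂ := w) x h1.hasDerivAt (hasDerivAt_neg x)
    refine ⟨h3.differentiableAt, ?_⟩
    have h4 : deriv (phi p) (-D u x) = deriv (phi p) (D u x) := by
      rw [(hasDerivAt_phi p hD).deriv, (hasDerivAt_phi p (neg_ne_zero.2 hD)).deriv, abs_neg]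
    rw [h3.deriv, h2, hDn, h4]
    ring
  equation x hx := by
    have hx' : -x ∈ Ioo (-1 : ℝ) 1 := ⟨by linarith [hx.2], by linarith [hx.1]⟩
    have h1 := ((hw.equation (-x) hx').comp x (hasDerivAt_neg x)).neg
    rw [hu.even h hlam (Ioo_subset_Icc_self hx)] at h1
    exact h1.congr_deriv (by ring)

/-- The Wronskian of `u'` and `w - (w(0) / u(0)) u` can be integrated in closed form, because
`u' (u f'(u) - (p - 1) f(u))` is the derivative of `H(u)`. -/
lemma wronskian (hw : IsLinearizedPair p f lam u w v) (hu : IsPositiveSolution p f lam u)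
    (h : Admissible p q γ f) (hlam : 0 < lam) {x : ℝ} (hx : x ∈ Ioo (0 : ℝ) 1) :
    D u x * (v x - w 0 / u 0 * ((p - 1) * phi p (D u x))) +
      lam * f (u x) * (w x - w 0 / u 0 * u x) =
      w 0 / u 0 * lam * (hump p f (u 0) - hump p f (u x)) := by
  have hM := (hu.apply_zero_mem h hlam).1
  have hsub : Icc 0 x ⊆ Ioo (-1 : ℝ) 1 := fun y hy => ⟨by linarith [hy.1], hy.2.trans_lt hx.2⟩
  have hsub' : Icc 0 x ⊆ Icc (-1 : ℝ) 1 := hsub.trans Ioo_subset_Icc_self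
  have hD0 : D u 0 = 0 := by
    rw [hu.D_of_mem_Icc h hlam ⟨le_rfl, zero_le_one⟩, speed_self h.one_lt, neg_zero]
  have huc := hu.continuousOn.mono hsub'
  have hun : MapsTo u (Icc 0 x) (Ici 0) := fun y hy => hu.nonneg (hsub' hy)
  have hc : ContinuousOn (fun x => D u x * (v x - w 0 / u 0 * ((p - 1) * phi p (D u x))) +
      lam * f (u x) * (w x - w 0 / u 0 * u x) +
      w 0 / u 0 * lam * hump p f (u x)) (Icc 0 x) := by
    have h1 := hu.continuousOn_D.mono hsub'
    have h2 : ContinuousOn v (Icc 0 x) := fun y hy =>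
      (hw.equation y (hsub hy)).continuousAt.continuousWithinAt
    have h3 : ContinuousOn (fun x => phi p (D u x)) (Icc 0 x) := fun y hy =>
      (hu.equation y (hsub hy)).continuousAt.continuousWithinAt
    have h4 : ContinuousOn (fun x => f (u x)) (Icc 0 x) := h.contDiffOn.continuousOn.comp huc hun
    have h5 : ContinuousOn (fun x => hump p f (u x)) (Icc 0 x) := h.continuousOn_hump.comp huc hun
    have h6 := hw.continuousOn.mono hsub'
    exact ((h1.mul (h2.sub ((h3.const_mul (p - 1)).const_mul (w 0 / u 0)))).add
      ((h4.const_mul lam).mul (h6.sub (huc.const_mul (w 0 / u 0))))).add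
      (h5.const_mul (w 0 / u 0 * lam))
  have hd : ∀ y ∈ Ioo 0 x,
      HasDerivAt (fun x => D u x * (v x - w 0 / u 0 * ((p - 1) * phi p (D u x))) +
        lam * f (u x) * (w x - w 0 / u 0 * u x) + w 0 / u 0 * lam * hump p f (u x)) 0 y := by
    intro y hy
    have hy' := hsub (Ioo_subset_Icc_self hy)
    have hDy : D u y ≠ 0 := (hu.D_neg_of_pos h hlam ⟨hy.1, hy.2.trans hx.2⟩).ne
    obtain ⟨s, hs, hseq⟩ := hu.exists_hasDerivAt_D h.one_lt hy' hDy
    obtain ⟨hwd, hv⟩ := hw.flux y hy' hDy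
    have hud := hu.hasDerivAt hy'
    have hup := hu.pos y hy'
    have hf : HasDerivAt (fun x => f (u x)) (deriv f (u y) * D u y) y :=
      HasDerivAt.comp (h₂ := f) y (h.hasDerivAt hup) hud
    have hh : HasDerivAt (fun x => hump p f (u x))
        ((u y * deriv f (u y) - (p - 1) * f (u y)) * D u y) y :=
      HasDerivAt.comp (h₂ := hump p f) y (h.hasDerivAt_hump hup) hud
    have hphi := ((hu.equation y hy').const_mul (p - 1)).const_mul (w 0 / u 0)
    have hw1 := hwd.hasDerivAt.sub (hud.const_mul (w 0 / u 0))
    have hmul := deriv_phi_mul (p := p) hDy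
    refine (((hs.mul ((hw.equation y hy').sub hphi)).add ((hf.const_mul lam).mul hw1)).add
      (hh.const_mul (w 0 / u 0 * lam))).congr_deriv ?_
    simp only [Pi.sub_apply]
    rw [hv, ← hmul]
    linear_combination (deriv w y - w 0 / u 0 * D u y) * hseq
  have h1 := eq_left_of_hasDerivAt_zero hc hd (x := x) ⟨hx.1.le, le_rfl⟩
  simp only [hD0, zero_mul, zero_add] at h1
  rw [div_mul_cancel₀ _ hM.ne', sub_self, mul_zero, zero_add] at h1
  linarith

/-- If `u'(1) = 0`, the Wronskian vanishes at the end point, so the linearized solution vanishes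
at the origin. -/
lemma apply_zero_of_D_eq_zero (hw : IsLinearizedPair p f lam u w v)
    (hu : IsPositiveSolution p f lam u) (h : Admissible p q γ f) (hlam : 0 < lam)
    (hD : D u 1 = 0) : w 0 = 0 := by
  have hA := hu.apply_zero_mem h hlam
  have hM := hA.1
  have h1mem : (1 : ℝ) ∈ Icc (-1 : ℝ) 1 := ⟨by norm_num, le_rfl⟩
  have hlim : ∀ k : ℝ → ℝ, ContinuousOn k (Icc (-1) 1) → Tendsto k (𝓝[<] 1) (𝓝 (k 1)) :=
    fun k hk => (hk 1 h1mem).mono_of_mem_nhdsWithin (Icc_mem_nhdsLT (by norm_num))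
  obtain ⟨C, hC⟩ : ∃ C, ∀ x ∈ Ioo (0 : ℝ) 1, |v x| ≤ C := by
    obtain ⟨B, hB⟩ := h.exists_deriv_bound (u 0)
    obtain ⟨W, hW⟩ := isCompact_Icc.exists_bound_of_continuousOn hw.continuousOn
    have hbd : ∀ x ∈ Ico (0 : ℝ) 1, ‖-(lam * deriv f (u x) * w x)‖ ≤ lam * B * W := by
      intro x hx
      have hx' : x ∈ Ioo (-1 : ℝ) 1 := ⟨by linarith [hx.1], hx.2⟩
      have h1 := hB (u x) ⟨hu.pos x hx', hu.le_apply_zero h hlam x (Ioo_subset_Icc_self hx')⟩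
      have h2 := hW x (Ioo_subset_Icc_self hx')
      rw [norm_neg, norm_mul, norm_mul, Real.norm_of_nonneg hlam.le]
      refine mul_le_mul (mul_le_mul_of_nonneg_left h1 hlam.le) h2 (norm_nonneg _) ?_
      exact mul_nonneg hlam.le ((abs_nonneg _).trans h1)
    refine ⟨lam * B * W + |v 0|, fun x hx => ?_⟩
    have h1 := (convex_Ico (0 : ℝ) 1).norm_image_sub_le_of_norm_hasDerivWithin_le
      (fun y hy => (hw.equation y ⟨by linarith [hy.1], hy.2⟩).hasDerivWithinAt) hbd
      ⟨le_rfl, one_pos⟩ ⟨hx.1.le, hx.2⟩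
    have h0 := (norm_nonneg _).trans (hbd 0 ⟨le_rfl, one_pos⟩)
    have h2 : |v x - v 0| ≤ lam * B * W := by
      refine h1.trans (mul_le_of_le_one_right h0 ?_)
      rw [sub_zero, Real.norm_of_nonneg hx.1.le]
      exact hx.2.le
    have h3 := abs_add_le (v x - v 0) (v 0)
    rw [sub_add_cancel] at h3
    linarith
  have hDl := hlim _ hu.continuousOn_D
  rw [hD] at hDl
  have hDv : Tendsto (fun x => D u x * v x) (𝓝[<] 1) (𝓝 0) := by
    have h1 : Tendsto (fun x => |D u x| * C) (𝓝[<] 1) (𝓝 0) := by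
      simpa using hDl.abs.mul_const C
    refine squeeze_zero_norm' ?_ h1
    filter_upwards [Ioo_mem_nhdsLT (zero_lt_one' ℝ)] with x hx
    rw [norm_mul]
    exact mul_le_mul_of_nonneg_left (hC x hx) (abs_nonneg _)
  have hphi : Tendsto (fun x => phi p (D u x)) (𝓝[<] 1) (𝓝 0) := by
    have := ((continuous_phi h.one_lt).tendsto 0).comp hDl
    rwa [phi_zero] at this
  have hul := hlim u hu.continuousOn
  have hwl := hlim w hw.continuousOn
  have hun : MapsTo u (Icc (-1) 1) (Ici 0) := fun y hy => hu.nonneg hy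
  have hfl := hlim _ (h.contDiffOn.continuousOn.comp hu.continuousOn hun)
  have hhl := hlim _ (h.continuousOn_hump.comp hu.continuousOn hun)
  simp only [Function.comp_def, hu.right] at hfl hhl
  rw [hu.right] at hul
  rw [hw.right] at hwl
  have hL : Tendsto (fun x => D u x * (v x - w 0 / u 0 * ((p - 1) * phi p (D u x))) +
      lam * f (u x) * (w x - w 0 / u 0 * u x)) (𝓝[<] 1) (𝓝 0) := by
    have := (hDv.sub (hDl.mul ((hphi.const_mul (p - 1)).const_mul (w 0 / u 0)))).add
      ((hfl.const_mul lam).mul (hwl.sub (hul.const_mul (w 0 / u 0))))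
    simp only [mul_zero, sub_zero, add_zero] at this
    refine this.congr fun x => ?_
    ring
  have hR := (hhl.const_sub (hump p f (u 0))).const_mul (w 0 / u 0 * lam)
  have heq := tendsto_nhds_unique (hL.congr' (by
    filter_upwards [Ioo_mem_nhdsLT (zero_lt_one' ℝ)] with x hx
    exact hw.wronskian hu h hlam hx)) hR
  have hH := h.hump_lt le_rfl hM (h.gamma_lt hM hA.2.1)
  have h2 : w 0 / u 0 = 0 := by
    rcases mul_eq_zero.1 heq.symm with h3 | h3
    · exact (mul_eq_zero.1 h3).resolve_right hlam.ne'
    · linarith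
  exact (div_eq_zero_iff.1 h2).resolve_right hM.ne'

/-- A linearized solution that is positive at the origin, with nonpositive flux there, cannot
vanish at an end point where `u'` does not: by the Wronskian identity the quotient of
`y = w - (w(0) / u(0)) u` and `u'` increases to `0`, so `y > 0` on `(0, 1)`, while the monotonicity
of `f(u) / u^(p-1)` makes the flux of `y` negative near the origin, so `y < 0` there. -/
lemma false_of_pos (hw : IsLinearizedPair p f lam u w v)
    (hu : IsPositiveSolution p f lam u) (h : Admissible p q γ f) (hlam : 0 < lam)
    (hD : D u 1 ≠ 0) (hw0 : 0 < w 0) (hv0 : v 0 ≤ 0) : False := by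
  have hA := hu.apply_zero_mem h hlam
  have hM := hA.1
  have hγ := h.gamma_lt hM hA.2.1
  have ha : 0 < w 0 / u 0 := div_pos hw0 hM
  have hsub : Ioo 0 1 ⊆ Ioo (-1 : ℝ) 1 := Ioo_subset_Ioo_left (by norm_num)
  have h0mem : (0 : ℝ) ∈ Ioo (-1 : ℝ) 1 := ⟨by norm_num, by norm_num⟩
  set a := w 0 / u 0 with hadef
  have hy0 : w 0 - a * u 0 = 0 := by rw [hadef, div_mul_cancel₀ _ hM.ne', sub_self]
  have hyc : ContinuousOn (fun x => w x - a * u x) (Icc (-1) 1) :=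
    hw.continuousOn.sub (continuousOn_const.mul hu.continuousOn)
  have hD0 : D u 0 = 0 := by
    rw [hu.D_of_mem_Icc h hlam ⟨le_rfl, zero_le_one⟩, speed_self h.one_lt, neg_zero]
  have hyd : ∀ x ∈ Ioo (0 : ℝ) 1, HasDerivAt (fun x => w x - a * u x) (deriv w x - a * D u x) x ∧
      deriv (phi p) (D u x) * (deriv w x - a * D u x) = v x - a * ((p - 1) * phi p (D u x)) := by
    intro x hx
    have hDx := (hu.D_neg_of_pos h hlam hx).ne
    obtain ⟨hwd, hv⟩ := hw.flux x (hsub hx) hDx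
    refine ⟨hwd.hasDerivAt.sub ((hu.hasDerivAt (hsub hx)).const_mul a), ?_⟩
    rw [hv, ← deriv_phi_mul hDx]
    ring
  have hypos : ∀ x ∈ Ioo (0 : ℝ) 1, 0 < w x - a * u x := by
    intro x hx
    have hDneg : ∀ y ∈ Icc x 1, D u y < 0 := by
      intro y hy
      rcases hy.2.eq_or_lt with rfl | hy1
      · refine lt_of_le_of_ne ?_ hD
        have h1 := hu.D_of_mem_Icc h hlam (x := 1) ⟨zero_le_one, le_rfl⟩
        have h2 := hu.abs_D h h0mem (hu.le_apply_zero h hlam) (x := 1) ⟨by norm_num, le_rfl⟩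
        have := abs_nonneg (D u 1)
        linarith
      · exact hu.D_neg_of_pos h hlam ⟨hx.1.trans_le hy.1, hy1⟩
    have hsubx : Icc x 1 ⊆ Icc (-1 : ℝ) 1 := Icc_subset_Icc_left (by linarith [hx.1])
    have hmono : StrictMonoOn (fun y => (w y - a * u y) / D u y) (Icc x 1) := by
      refine strictMonoOn_of_deriv_pos (convex_Icc x 1)
        ((hyc.mono hsubx).div (hu.continuousOn_D.mono hsubx) fun y hy => (hDneg y hy).ne)
        fun y hy => ?_
      rw [interior_Icc] at hy
      have hy' : y ∈ Ioo (0 : ℝ) 1 := ⟨hx.1.trans hy.1, hy.2⟩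
      have hDy := (hu.D_neg_of_pos h hlam hy').ne
      obtain ⟨s, hs, hseq⟩ := hu.exists_hasDerivAt_D h.one_lt (hsub hy') hDy
      obtain ⟨h1, h2⟩ := hyd y hy'
      rw [(h1.fun_div hs hDy).deriv]
      refine div_pos ?_ (by positivity)
      refine pos_of_mul_pos_right ?_ (deriv_phi_pos (p := p) h.one_lt hDy).le
      have h3 := hw.wronskian hu h hlam hy'
      have h4 : 0 < a * lam * (hump p f (u 0) - hump p f (u y)) := by
        refine mul_pos (mul_pos ha hlam) (sub_pos.2 (h.hump_lt (hu.nonneg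
          (Ioo_subset_Icc_self (hsub hy'))) ?_ hγ))
        exact hu.lt_max h hlam h0mem (hu.le_apply_zero h hlam) hy'
      have h5 : deriv (phi p) (D u y) * ((deriv w y - a * D u y) * D u y -
          (w y - a * u y) * s) = a * lam * (hump p f (u 0) - hump p f (u y)) := by
        rw [← h3]
        linear_combination D u y * h2 - (w y - a * u y) * hseq
      rw [h5]
      exact h4
    have h1 := hmono ⟨le_rfl, hx.2.le⟩ ⟨hx.2.le, le_rfl⟩ hx.2
    simp only [hw.right, hu.right, mul_zero, sub_zero, zero_div] at h1
    have hDx := hDneg x ⟨le_rfl, hx.2.le⟩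
    by_contra! hle
    exact absurd h1 (div_nonneg_of_nonpos hle hDx.le).not_gt
  -- The flux of `y` decreases near the origin.
  have hev : ∀ᶠ x in 𝓝 (0 : ℝ),
      -(lam * deriv f (u x) * w x) - a * ((p - 1) * -(lam * f (u x))) < 0 := by
    have huc : ContinuousAt u 0 := (hu.hasDerivAt h0mem).continuousAt
    have hwc : ContinuousAt w 0 := hw.continuousOn.continuousAt (Icc_mem_nhds h0mem.1 h0mem.2)
    have hfc : ContinuousAt (fun x => f (u x)) 0 :=
      ContinuousAt.comp (g := f) (h.hasDerivAt hM).continuousAt huc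
    have hfc' : ContinuousAt (fun x => deriv f (u x)) 0 :=
      ContinuousAt.comp (g := deriv f) (h.continuousOn_deriv.continuousAt (Ioi_mem_nhds hM)) huc
    have hc : ContinuousAt
        (fun x => -(lam * deriv f (u x) * w x) - a * ((p - 1) * -(lam * f (u x)))) 0 :=
      ((hfc'.const_mul lam).mul hwc).neg.sub
        (((hfc.const_mul lam).neg.const_mul (p - 1)).const_mul a)
    refine hc.eventually_lt_const ?_
    have h1 := mul_pos (mul_pos hlam hw0) (h.incr (u 0) hγ)
    have h2 : -(lam * deriv f (u 0) * w 0) - a * ((p - 1) * -(lam * f (u 0))) =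
        -(lam * w 0 * (deriv f (u 0) - (p - 1) * (f (u 0) / u 0))) := by
      rw [hadef]
      ring
    simp only [h2]
    linarith
  obtain ⟨ε, hε, hball⟩ := Metric.eventually_nhds_iff.1 hev
  set δ := min ε 1 / 2 with hδ
  have hm := lt_min hε one_pos
  have hδ0 : 0 < δ := by positivity
  have hδ1 : δ < 1 := by have := min_le_right ε 1; linarith
  have hδε : δ < ε := by have := min_le_left ε 1; linarith
  have hsubδ : Icc 0 δ ⊆ Ioo (-1 : ℝ) 1 := fun x hx => ⟨by linarith [hx.1], hx.2.trans_lt hδ1⟩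
  have hmd : ∀ x ∈ Icc 0 δ, HasDerivAt (fun x => v x - a * ((p - 1) * phi p (D u x)))
      (-(lam * deriv f (u x) * w x) - a * ((p - 1) * -(lam * f (u x)))) x := fun x hx =>
    (hw.equation x (hsubδ hx)).sub (((hu.equation x (hsubδ hx)).const_mul _).const_mul _)
  have hmanti : StrictAntiOn (fun x => v x - a * ((p - 1) * phi p (D u x))) (Icc 0 δ) := by
    refine strictAntiOn_of_deriv_neg (convex_Icc 0 δ)
      (fun x hx => (hmd x hx).continuousAt.continuousWithinAt) fun x hx => ?_
    have hx' := interior_subset hx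
    rw [(hmd x hx').deriv]
    apply hball
    rw [Real.dist_eq, sub_zero, abs_of_nonneg hx'.1]
    exact hx'.2.trans_lt hδε
  have hmneg : ∀ x ∈ Ioc 0 δ, v x - a * ((p - 1) * phi p (D u x)) < 0 := by
    intro x hx
    have h1 := hmanti ⟨le_rfl, hδ0.le⟩ ⟨hx.1.le, hx.2⟩ hx.1
    simp only [hD0, phi_zero, mul_zero, sub_zero] at h1
    linarith
  have hyanti : StrictAntiOn (fun x => w x - a * u x) (Icc 0 δ) := by
    refine strictAntiOn_of_deriv_neg (convex_Icc 0 δ)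
      (hyc.mono (hsubδ.trans Ioo_subset_Icc_self)) fun x hx => ?_
    rw [interior_Icc] at hx
    have hx1 : x ∈ Ioo (0 : ℝ) 1 := ⟨hx.1, hx.2.trans hδ1⟩
    obtain ⟨h1, h2⟩ := hyd x hx1
    rw [h1.deriv]
    have h3 := deriv_phi_pos (p := p) h.one_lt (hu.D_neg_of_pos h hlam hx1).ne
    have h4 := hmneg x ⟨hx.1, hx.2.le⟩
    rw [← h2] at h4
    exact neg_of_mul_neg_right h4 h3.le
  have h1 := hyanti ⟨le_rfl, hδ0.le⟩ ⟨hδ0.le, le_rfl⟩ hδ0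
  have h2 := hypos δ ⟨hδ0, hδ1⟩
  simp only [hy0] at h1
  linarith

/-- Every linearized solution vanishes at the origin. -/
lemma apply_zero (hw : IsLinearizedPair p f lam u w v) (hu : IsPositiveSolution p f lam u)
    (h : Admissible p q γ f) (hlam : 0 < lam) : w 0 = 0 := by
  by_cases hD : D u 1 = 0
  · exact hw.apply_zero_of_D_eq_zero hu h hlam hD
  have hwr := hw.comp_neg hu h hlam
  rcases lt_trichotomy (w 0) 0 with hneg | h0 | hpos
  · exfalso
    rcases le_total (v 0) 0 with hv | hv
    · exact hwr.neg.false_of_pos hu h hlam hD (by simpa using hneg) (by simpa using hv)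
    · exact hw.neg.false_of_pos hu h hlam hD (by simpa using hneg) (by simpa using hv)
  · exact h0
  · exfalso
    rcases le_total (v 0) 0 with hv | hv
    · exact hw.false_of_pos hu h hlam hD hpos hv
    · exact hwr.false_of_pos hu h hlam hD (by simpa using hpos) (by simpa using hv)

/-- As its Wronskian with `u'` vanishes, a linearized solution is a multiple of `u'` on
`(0, 1)`. -/
lemma exists_eq_mul_D (hw : IsLinearizedPair p f lam u w v) (hu : IsPositiveSolution p f lam u)
    (h : Admissible p q γ f) (hlam : 0 < lam) :
    ∃ c, ∀ x ∈ Ioo (0 : ℝ) 1, w x = c * D u x ∧ v x = -(c * (lam * f (u x))) := by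
  have hw0 := hw.apply_zero hu h hlam
  have hsub : Ioo 0 1 ⊆ Ioo (-1 : ℝ) 1 := Ioo_subset_Ioo_left (by norm_num)
  have hwr : ∀ x ∈ Ioo (0 : ℝ) 1, D u x * v x + lam * f (u x) * w x = 0 := by
    intro x hx
    have := hw.wronskian hu h hlam hx
    simpa [hw0] using this
  have hd : ∀ x ∈ Ioo (0 : ℝ) 1, HasDerivAt (fun x => w x / D u x) 0 x := by
    intro x hx
    have hDx := (hu.D_neg_of_pos h hlam hx).ne
    obtain ⟨s, hs, hseq⟩ := hu.exists_hasDerivAt_D h.one_lt (hsub hx) hDx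
    obtain ⟨hwd, hv⟩ := hw.flux x (hsub hx) hDx
    refine (hwd.hasDerivAt.fun_div hs hDx).congr_deriv ?_
    have h1 : deriv (phi p) (D u x) * (deriv w x * D u x - w x * s) = 0 := by
      have := hwr x hx
      rw [hv] at this
      linear_combination this - w x * hseq
    rw [(mul_eq_zero.1 h1).resolve_left (deriv_phi_pos h.one_lt hDx).ne', zero_div]
  refine ⟨w (1 / 2) / D u (1 / 2), fun x hx => ?_⟩
  have hDx := (hu.D_neg_of_pos h hlam hx).ne
  have h1 : w x / D u x = w (1 / 2) / D u (1 / 2) :=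
    isOpen_Ioo.is_const_of_deriv_eq_zero isPreconnected_Ioo
      (fun y hy => (hd y hy).differentiableAt.differentiableWithinAt)
      (fun y hy => (hd y hy).deriv) hx ⟨by norm_num, by norm_num⟩
  have h2 : w x = w (1 / 2) / D u (1 / 2) * D u x := by
    rw [← h1, div_mul_cancel₀ _ hDx]
  refine ⟨h2, mul_left_cancel₀ hDx ?_⟩
  have h3 := hwr x hx
  rw [h2] at h3
  linear_combination h3

lemma eq_zero_of_right (hw : IsLinearizedPair p f lam u w v) (hu : IsPositiveSolution p f lam u)
    (h : Admissible p q γ f) (hlam : 0 < lam) (hr : ∀ x ∈ Ioo (0 : ℝ) 1, w x = 0)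
    {x : ℝ} (hx : x ∈ Icc (0 : ℝ) 1) : w x = 0 := by
  rcases hx.1.eq_or_lt with rfl | hx0
  · exact hw.apply_zero hu h hlam
  · rcases hx.2.eq_or_lt with rfl | hx1
    · exact hw.right
    · exact hr x ⟨hx0, hx1⟩

lemma eq_zero_of_D_ne_zero (hw : IsLinearizedPair p f lam u w v)
    (hu : IsPositiveSolution p f lam u) (h : Admissible p q γ f) (hlam : 0 < lam)
    (hD : D u 1 ≠ 0) {x : ℝ} (hx : x ∈ Icc (0 : ℝ) 1) : w x = 0 := by
  obtain ⟨c, hc⟩ := hw.exists_eq_mul_D hu h hlam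
  have hmem : Icc (-1 : ℝ) 1 ∈ 𝓝[<] (1 : ℝ) := Icc_mem_nhdsLT (by norm_num)
  have h1 : Tendsto w (𝓝[<] 1) (𝓝 (w 1)) :=
    (hw.continuousOn 1 ⟨by norm_num, le_rfl⟩).mono_of_mem_nhdsWithin hmem
  have h2 : Tendsto (D u) (𝓝[<] 1) (𝓝 (D u 1)) :=
    (hu.continuousOn_D 1 ⟨by norm_num, le_rfl⟩).mono_of_mem_nhdsWithin hmem
  have h3 := tendsto_nhds_unique (h1.congr' (by
    filter_upwards [Ioo_mem_nhdsLT (zero_lt_one' ℝ)] with x hx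
    exact (hc x hx).1)) (h2.const_mul c)
  rw [hw.right] at h3
  have hc0 : c = 0 := (mul_eq_zero.1 h3.symm).resolve_right hD
  exact hw.eq_zero_of_right hu h hlam (fun y hy => by rw [(hc y hy).1, hc0, zero_mul]) hx

end IsLinearizedPair

namespace IsPositiveSolution

variable {p q γ lam : ℝ} {f u : ℝ → ℝ}

lemma nondegenerate (hu : IsPositiveSolution p f lam u) (h : Admissible p q γ f)
    (hlam : 0 < lam) (hD : D u 1 ≠ 0) : Nondegenerate p f lam u := by
  intro w hw x hx
  obtain ⟨v, hv⟩ := hw.exists_pair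
  rcases le_total 0 x with hx0 | hx0
  · exact hv.eq_zero_of_D_ne_zero hu h hlam hD ⟨hx0, hx.2⟩
  · have := (hv.comp_neg hu h hlam).eq_zero_of_D_ne_zero hu h hlam hD (x := -x)
      ⟨by linarith, by linarith [hx.1]⟩
    simpa using this

lemma nondegenerateEven (hu : IsPositiveSolution p f lam u) (h : Admissible p q γ f)
    (hlam : 0 < lam) : NondegenerateEven p f lam u := by
  intro w hw hev x hx
  obtain ⟨v, hv⟩ := hw.exists_pair
  obtain ⟨c, hc⟩ := hv.exists_eq_mul_D hu h hlam
  obtain ⟨c', hc'⟩ := (hv.comp_neg hu h hlam).exists_eq_mul_D hu h hlam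
  have hhalf : (1 / 2 : ℝ) ∈ Ioo (0 : ℝ) 1 := ⟨by norm_num, by norm_num⟩
  have hcc : c' = c := by
    have h1 := (hc' _ hhalf).1
    have h2 := (hc _ hhalf).1
    rw [hev _ ⟨by norm_num, by norm_num⟩, h2] at h1
    exact (mul_right_cancel₀ (hu.D_neg_of_pos h hlam hhalf).ne h1).symm
  -- The flux `-c λ f(u)` is even, and that of an even function is odd, so `c = 0`.
  have h0mem : (0 : ℝ) ∈ Ioo (-1 : ℝ) 1 := ⟨by norm_num, by norm_num⟩
  have hA := hu.apply_zero_mem h hlam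
  have hvc : Tendsto v (𝓝[>] 0) (𝓝 (v 0)) :=
    (hv.equation 0 h0mem).continuousAt.tendsto.mono_left nhdsWithin_le_nhds
  have hvc' : Tendsto (fun x => -v (-x)) (𝓝[>] 0) (𝓝 (-v (-0))) :=
    ((hv.comp_neg hu h hlam).equation 0 h0mem).continuousAt.tendsto.mono_left nhdsWithin_le_nhds
  have hfc : Tendsto (fun x => -(c * (lam * f (u x)))) (𝓝[>] 0) (𝓝 (-(c * (lam * f (u 0))))) := by
    have h1 : ContinuousAt (fun x => f (u x)) 0 :=
      ContinuousAt.comp (g := f) (h.hasDerivAt hA.1).continuousAt (hu.hasDerivAt h0mem).continuousAt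
    exact ((((h1.tendsto).const_mul lam).const_mul c).neg).mono_left nhdsWithin_le_nhds
  have hmem : Ioo (0 : ℝ) 1 ∈ 𝓝[>] (0 : ℝ) := Ioo_mem_nhdsGT one_pos
  have h1 := tendsto_nhds_unique (hvc.congr' (by
    filter_upwards [hmem] with x hx using (hc x hx).2)) hfc
  have h2 := tendsto_nhds_unique (hvc'.congr' (by
    filter_upwards [hmem] with x hx
    rw [(hc' x hx).2, hcc])) hfc
  rw [neg_zero] at h2
  have hf : lam * f (u 0) ≠ 0 := (mul_pos hlam (h.pos _ (h.gamma_lt hA.1 hA.2.1))).ne'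
  have hc0 : c = 0 := by
    have h3 : c * (lam * f (u 0)) = 0 := by linarith
    exact (mul_eq_zero.1 h3).resolve_right hf
  have hpos : ∀ y ∈ Icc (0 : ℝ) 1, w y = 0 := fun y hy =>
    hv.eq_zero_of_right hu h hlam (fun z hz => by rw [(hc z hz).1, hc0, zero_mul]) hy
  rcases le_total 0 x with hx0 | hx0
  · exact hpos x ⟨hx0, hx.2⟩
  · rw [← hev x hx]
    exact hpos (-x) ⟨by linarith, by linarith [hx.1]⟩

end IsPositiveSolution

/-! ### The solution curve -/

namespace Admissible

variable {p q γ lam : ℝ} {f : ℝ → ℝ}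

/-- Every admissible amplitude belongs to some value of the parameter. -/
lemma exists_solution_of_mem (h : Admissible p q γ f) {M : ℝ} (hM : M ∈ amplitudes p f) :
    ∃ lam > 0, ∃ u, IsPositiveSolution p f lam u ∧ u 0 = M := by
  have hp1 : 0 < p - 1 := by linarith [h.one_lt]
  have hp0 : 0 < p := by linarith
  have hT := h.tail_zero_pos hM
  have hTp := Real.rpow_pos_of_pos hT p
  have hlam : 0 < (p - 1) / p * tail p f M 0 ^ p := by positivity
  refine ⟨_, hlam, h.exists_solution hlam hM ?_⟩
  have h1 : p / (p - 1) * ((p - 1) / p * tail p f M 0 ^ p) = tail p f M 0 ^ p := by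
    field_simp
  rw [h1, ← Real.rpow_mul hT.le, mul_one_div_cancel hp0.ne', Real.rpow_one]

lemma scale_lt_scale (h : Admissible p q γ f) {lam₁ lam₂ : ℝ} (h₁ : 0 < lam₁) (h₂ : 0 < lam₂) :
    (p / (p - 1) * lam₁) ^ (1 / p) < (p / (p - 1) * lam₂) ^ (1 / p) ↔ lam₁ < lam₂ := by
  have hp1 : 0 < p - 1 := by linarith [h.one_lt]
  have hp0 : 0 < p := by linarith
  rw [Real.rpow_lt_rpow_iff (by positivity) (by positivity) (by positivity)]
  exact mul_lt_mul_iff_right₀ (by positivity)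

end Admissible

namespace IsPositiveSolution

variable {p q γ lam lam' : ℝ} {f u u' : ℝ → ℝ}

/-- Larger values of the parameter belong to smaller solutions. -/
lemma apply_zero_lt_iff (hu : IsPositiveSolution p f lam u) (hu' : IsPositiveSolution p f lam' u')
    (h : Admissible p q γ f) (hlam : 0 < lam) (hlam' : 0 < lam') :
    u' 0 < u 0 ↔ lam < lam' := by
  rw [← h.scale_lt_scale hlam hlam', ← hu.timeMap_eq h hlam, ← hu'.timeMap_eq h hlam']
  exact (h.strictAntiOn_timeMap.lt_iff_gt (hu.apply_zero_mem h hlam)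
    (hu'.apply_zero_mem h hlam')).symm

lemma exists_of_le (hu : IsPositiveSolution p f lam u) (h : Admissible p q γ f) (hlam' : 0 < lam')
    (hle : lam' ≤ lam) : ∃ u', IsPositiveSolution p f lam' u' := by
  have hp1 : 0 < p - 1 := by linarith [h.one_lt]
  have hp0 : 0 < p := by linarith
  have hlam := hlam'.trans_le hle
  obtain ⟨M, hM, hT⟩ := h.exists_timeMap_eq (hu.apply_zero_mem h hlam)
    (y := (p / (p - 1) * lam') ^ (1 / p)) (Real.rpow_pos_of_pos (by positivity) _) (by
      rw [hu.timeMap_eq h hlam]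
      exact not_lt.1 (by rw [h.scale_lt_scale hlam hlam']; exact hle.not_gt))
  obtain ⟨u', hu', -⟩ := h.exists_solution hlam' hM hT
  exact ⟨u', hu'⟩

lemma D_one_ne_zero (hu : IsPositiveSolution p f lam u) (h : Admissible p q γ f) (hlam : 0 < lam)
    (hF : 0 < prim f (u 0)) : D u 1 ≠ 0 := by
  have hp1 : 0 < p - 1 := by linarith [h.one_lt]
  have hp0 : 0 < p := by linarith
  rw [hu.D_of_mem_Icc h hlam ⟨zero_le_one, le_rfl⟩, hu.right, speed, prim_zero, sub_zero]
  exact neg_ne_zero.2 (Real.rpow_pos_of_pos (by positivity) _).ne'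

/-- Two solutions are compared at points of equal relative height: there the distance of the
points is controlled by the `L¹`-distance of the integrands of the time map. -/
lemma exists_comparison {u₀ : ℝ → ℝ} {lam₀ : ℝ} (hu : IsPositiveSolution p f lam u)
    (hu₀ : IsPositiveSolution p f lam₀ u₀) (h : Admissible p q γ f) (hlam : 0 < lam)
    (hlam₀ : 0 < lam₀) {x : ℝ} (hx : x ∈ Icc (0 : ℝ) 1) : ∃ y ∈ Icc (0 : ℝ) 1,
      |u₀ y - u x| ≤ |u 0 - u₀ 0| ∧
      |x - y| ≤ 2 * (∫ t in Ioo 0 1, |ker p f (u 0) t - ker p f (u₀ 0) t|) / tail p f (u 0) 0 := by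
  have hA := hu.apply_zero_mem h hlam
  have hA₀ := hu₀.apply_zero_mem h hlam₀
  have hT := h.tail_zero_pos hA
  have hT₀ := h.tail_zero_pos hA₀
  have hx' : x ∈ Icc (-1 : ℝ) 1 := ⟨by linarith [hx.1], hx.2⟩
  set t := u x / u 0 with htdef
  have ht : t ∈ Icc (0 : ℝ) 1 := hu.div_mem h hlam hx'
  have hxt : tail p f (u 0) t = tail p f (u 0) 0 * x := by
    rw [hu.tail_eq h hlam hx', hu.timeMap_eq h hlam, abs_of_nonneg hx.1]
  have htn := h.tail_nonneg hA₀ ht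
  have htle : tail p f (u₀ 0) t ≤ tail p f (u₀ 0) 0 :=
    (h.strictAntiOn_tail hA₀).antitoneOn ⟨le_rfl, zero_le_one⟩ ht ht.1
  set y := tail p f (u₀ 0) t / tail p f (u₀ 0) 0 with hydef
  have hy : y ∈ Icc (0 : ℝ) 1 := ⟨div_nonneg htn hT₀.le, (div_le_one hT₀).2 htle⟩
  have hy' : y ∈ Icc (-1 : ℝ) 1 := ⟨by linarith [hy.1], hy.2⟩
  have hyt : tail p f (u₀ 0) 0 * y = tail p f (u₀ 0) t := mul_div_cancel₀ _ hT₀.ne'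
  have hu₀y : u₀ y = t * u₀ 0 := by
    have h1 := hu₀.tail_eq h hlam₀ hy'
    rw [← hu₀.timeMap_eq h hlam₀, abs_of_nonneg hy.1, hyt] at h1
    exact (div_eq_iff hA₀.1.ne').1 ((h.strictAntiOn_tail hA₀).injOn (hu₀.div_mem h hlam₀ hy') ht h1)
  have hux : u x = t * u 0 := (div_mul_cancel₀ _ hA.1.ne').symm
  refine ⟨y, hy, ?_, ?_⟩
  · rw [hu₀y, hux, ← mul_sub, abs_mul, abs_of_nonneg ht.1, abs_sub_comm]
    exact mul_le_of_le_one_left (abs_nonneg _) ht.2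
  · set I := ∫ t in Ioo 0 1, |ker p f (u 0) t - ker p f (u₀ 0) t|
    have h1 : |tail p f (u 0) t - tail p f (u₀ 0) t| ≤ I := abs_tail_sub_le hA hA₀ ht
    have h2 : |tail p f (u 0) 0 - tail p f (u₀ 0) 0| ≤ I :=
      abs_tail_sub_le hA hA₀ ⟨le_rfl, zero_le_one⟩
    have h3 : (x - y) * tail p f (u 0) 0 = (tail p f (u 0) t - tail p f (u₀ 0) t) -
        y * (tail p f (u 0) 0 - tail p f (u₀ 0) 0) := by
      rw [hxt, ← hyt]
      ring
    have h5 : |x - y| * tail p f (u 0) 0 = |(x - y) * tail p f (u 0) 0| := by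
      rw [abs_mul, abs_of_pos hT]
    rw [le_div_iff₀ hT, h5, h3]
    refine (abs_sub _ _).trans ?_
    rw [abs_mul, abs_of_nonneg hy.1]
    have h4 : y * |tail p f (u 0) 0 - tail p f (u₀ 0) 0| ≤ I :=
      (mul_le_of_le_one_left (abs_nonneg _) hy.2).trans h2
    linarith

end IsPositiveSolution

section Curve

variable {p q γ lam₀ : ℝ} {f : ℝ → ℝ} {Λ : Set ℝ} {U : ℝ → ℝ → ℝ}

/-- The maximum depends continuously on the parameter, since the correspondence is strictly
monotone and the amplitudes form an upper set. -/
lemma tendsto_apply_zero (h : Admissible p q γ f) (hΛ : Λ ⊆ Ioi 0)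
    (hU : ∀ lam ∈ Λ, IsPositiveSolution p f lam (U lam)) (h₀ : lam₀ ∈ Λ) :
    Tendsto (fun lam => U lam 0) (𝓝[Λ] lam₀) (𝓝[amplitudes p f] (U lam₀ 0)) := by
  refine tendsto_nhdsWithin_iff.2 ⟨tendsto_order.2 ⟨fun a ha => ?_, fun b hb => ?_⟩, ?_⟩
  · by_cases haA : a ∈ amplitudes p f
    · obtain ⟨l, hl, v, hv, rfl⟩ := h.exists_solution_of_mem haA
      have hlt := ((hU _ h₀).apply_zero_lt_iff hv h (hΛ h₀) hl).1 ha
      filter_upwards [self_mem_nhdsWithin, mem_nhdsWithin_of_mem_nhds (Iio_mem_nhds hlt)]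
        with m hm hml
      exact ((hU m hm).apply_zero_lt_iff hv h (hΛ hm) hl).2 hml
    · filter_upwards [self_mem_nhdsWithin] with m hm
      by_contra! hle
      exact haA (h.amplitudes_mono ((hU m hm).apply_zero_mem h (hΛ hm)) hle)
  · obtain ⟨l, hl, v, hv, rfl⟩ := h.exists_solution_of_mem
      (h.amplitudes_mono ((hU _ h₀).apply_zero_mem h (hΛ h₀)) hb.le)
    have hlt := (hv.apply_zero_lt_iff (hU _ h₀) h hl (hΛ h₀)).1 hb
    filter_upwards [self_mem_nhdsWithin, mem_nhdsWithin_of_mem_nhds (Ioi_mem_nhds hlt)]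
      with m hm hml
    exact (hv.apply_zero_lt_iff (hU m hm) h hl (hΛ hm)).2 hml
  · filter_upwards [self_mem_nhdsWithin] with m hm
    exact (hU m hm).apply_zero_mem h (hΛ hm)

lemma tendstoUniformlyOn_curve (h : Admissible p q γ f) (hΛ : Λ ⊆ Ioi 0)
    (hU : ∀ lam ∈ Λ, IsPositiveSolution p f lam (U lam)) (h₀ : lam₀ ∈ Λ) :
    TendstoUniformlyOn U (U lam₀) (𝓝[Λ] lam₀) (Icc (-1) 1) := by
  have hM := tendsto_apply_zero h hΛ hU h₀
  have hu₀ := hU lam₀ h₀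
  have hA₀ := hu₀.apply_zero_mem h (hΛ h₀)
  have hI := (h.tendsto_integral_abs_ker_sub hA₀).comp hM
  have hT := (h.continuousOn_timeMap _ hA₀).tendsto.comp hM
  have hR : Tendsto (fun lam => 2 * (∫ t in Ioo 0 1, |ker p f (U lam 0) t - ker p f (U lam₀ 0) t|) /
      tail p f (U lam 0) 0) (𝓝[Λ] lam₀) (𝓝 0) := by
    have := (hI.const_mul 2).div hT (h.tail_zero_pos hA₀).ne'
    rw [mul_zero, zero_div] at this
    exact this
  have hMabs : Tendsto (fun lam => |U lam 0 - U lam₀ 0|) (𝓝[Λ] lam₀) (𝓝 0) := by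
    have := ((hM.mono_right nhdsWithin_le_nhds).sub_const (U lam₀ 0)).abs
    rwa [sub_self, abs_zero] at this
  rw [Metric.tendstoUniformlyOn_iff]
  intro ε hε
  obtain ⟨δ, hδ, huc⟩ := Metric.uniformContinuousOn_iff.1
    (isCompact_Icc.uniformContinuousOn_of_continuous hu₀.continuousOn) (ε / 2) (half_pos hε)
  filter_upwards [self_mem_nhdsWithin, hR.eventually (gt_mem_nhds hδ),
    hMabs.eventually (gt_mem_nhds (half_pos hε))] with m hm h1 h2
  have hu := hU m hm
  have key : ∀ x ∈ Icc (0 : ℝ) 1, dist (U lam₀ x) (U m x) < ε := by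
    intro x hx
    obtain ⟨y, hy, h3, h4⟩ := hu.exists_comparison hu₀ h (hΛ hm) (hΛ h₀) hx
    have h5 := huc x ⟨by linarith [hx.1], hx.2⟩ y ⟨by linarith [hy.1], hy.2⟩
      (by rw [Real.dist_eq]; exact h4.trans_lt h1)
    have h6 := dist_triangle (U lam₀ x) (U lam₀ y) (U m x)
    rw [Real.dist_eq (U lam₀ y)] at h6
    linarith
  intro x hx
  rcases le_total 0 x with hx0 | hx0
  · exact key x ⟨hx0, hx.2⟩
  · rw [← hu₀.even h (hΛ h₀) hx, ← hu.even h (hΛ hm) hx]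
    exact key (-x) ⟨by linarith, by linarith [hx.1]⟩

lemma tendstoUniformlyOn_curve_D (h : Admissible p q γ f) (hΛ : Λ ⊆ Ioi 0)
    (hU : ∀ lam ∈ Λ, IsPositiveSolution p f lam (U lam)) (h₀ : lam₀ ∈ Λ) :
    TendstoUniformlyOn (fun m => D (U m)) (D (U lam₀)) (𝓝[Λ] lam₀) (Icc (-1) 1) := by
  have hM := (tendsto_apply_zero h hΛ hU h₀).mono_right nhdsWithin_le_nhds
  have hu₀ := hU lam₀ h₀
  have hp0 : 0 < p := by linarith [h.one_lt]
  have hsp : Continuous fun a : ℝ × ℝ × ℝ => speed p f a.1 a.2.1 a.2.2 := by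
    refine Continuous.rpow_const ?_ fun _ => Or.inr (by positivity)
    have := h.continuous_prim
    fun_prop
  have hK : IsCompact (Icc 0 (lam₀ + 1) ×ˢ Icc 0 (U lam₀ 0 + 1) ×ˢ Icc 0 (U lam₀ 0 + 1)) :=
    isCompact_Icc.prod (isCompact_Icc.prod isCompact_Icc)
  rw [Metric.tendstoUniformlyOn_iff]
  intro ε hε
  obtain ⟨δ, hδ, huc⟩ := Metric.uniformContinuousOn_iff.1
    (hK.uniformContinuousOn_of_continuous hsp.continuousOn) ε hε
  have hid : Tendsto (fun m : ℝ => m) (𝓝[Λ] lam₀) (𝓝 lam₀) := nhdsWithin_le_nhds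
  have hmem : ∀ m ∈ Λ, m < lam₀ + 1 → U m 0 < U lam₀ 0 + 1 → ∀ x ∈ Icc (-1 : ℝ) 1,
      (m, U m 0, U m x) ∈
        Icc 0 (lam₀ + 1) ×ˢ Icc 0 (U lam₀ 0 + 1) ×ˢ Icc 0 (U lam₀ 0 + 1) := by
    intro m hm h1 h2 x hx
    have h3 := (hU m hm).le_apply_zero h (hΛ hm) x hx
    exact ⟨⟨le_of_lt (hΛ hm), h1.le⟩, ⟨((hU m hm).apply_zero_mem h (hΛ hm)).1.le, h2.le⟩,
      (hU m hm).nonneg hx, h3.trans h2.le⟩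
  filter_upwards [self_mem_nhdsWithin, hid.eventually (Metric.ball_mem_nhds lam₀ hδ),
    hM.eventually (Metric.ball_mem_nhds _ hδ), hid.eventually (gt_mem_nhds (lt_add_one lam₀)),
    hM.eventually (gt_mem_nhds (lt_add_one _)),
    Metric.tendstoUniformlyOn_iff.1 (tendstoUniformlyOn_curve h hΛ hU h₀) δ hδ]
    with m hm h1 h2 h3 h4 h5
  have hu := hU m hm
  have key : ∀ x ∈ Icc (0 : ℝ) 1, dist (D (U lam₀) x) (D (U m) x) < ε := by
    intro x hx
    have hx' : x ∈ Icc (-1 : ℝ) 1 := ⟨by linarith [hx.1], hx.2⟩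
    rw [hu₀.D_of_mem_Icc h (hΛ h₀) hx, hu.D_of_mem_Icc h (hΛ hm) hx, dist_neg_neg, dist_comm]
    refine huc (m, U m 0, U m x) (hmem m hm h3 h4 x hx') (lam₀, U lam₀ 0, U lam₀ x)
      (hmem lam₀ h₀ (lt_add_one _) (lt_add_one _) x hx') ?_
    refine max_lt h1 (max_lt h2 ?_)
    rw [dist_comm]
    exact h5 x hx'
  intro x hx
  rcases le_total 0 x with hx0 | hx0
  · exact key x ⟨hx0, hx.2⟩
  · have hx' : -x ∈ Icc (-1 : ℝ) 1 := ⟨by linarith [hx.2], by linarith [hx.1]⟩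
    have h6 := hu₀.D_neg h (hΛ h₀) hx'
    have h7 := hu.D_neg h (hΛ hm) hx'
    rw [neg_neg] at h6 h7
    rw [h6, h7, dist_neg_neg]
    exact key (-x) ⟨by linarith, by linarith [hx.1]⟩

lemma isSolutionCurve (h : Admissible p q γ f) (hΛ : Λ ⊆ Ioi 0)
    (hU : ∀ lam ∈ Λ, IsPositiveSolution p f lam (U lam))
    (hall : ∀ lam, 0 < lam → ∀ u, IsPositiveSolution p f lam u → lam ∈ Λ) :
    IsSolutionCurve p f Λ U where
  solution := hU
  all lam hlam u hu := ⟨hall lam hlam u hu, hu.eqOn (hU lam (hall lam hlam u hu)) h hlam⟩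
  continuous _ h₀ := tendstoUniformlyOn_curve h hΛ hU h₀
  continuous_deriv _ h₀ := tendstoUniformlyOn_curve_D h hΛ hU h₀

lemma tendsto_apply_zero_atTop (h : Admissible p q γ f) (hΛ : Λ ⊆ Ioi 0)
    (hU : ∀ lam ∈ Λ, IsPositiveSolution p f lam (U lam)) (h0 : Λ ∈ 𝓝[>] (0 : ℝ)) :
    Tendsto (fun lam => U lam 0) (𝓝[>] 0) atTop := by
  refine tendsto_atTop.2 fun B => ?_
  obtain ⟨M, hM⟩ := h.exists_mem_amplitudes
  obtain ⟨l, hl, v, hv, hv0⟩ := h.exists_solution_of_mem (h.amplitudes_mono hM (le_max_right B M))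
  filter_upwards [h0, Ioo_mem_nhdsGT hl] with m hm hml
  have := ((hU m hm).apply_zero_lt_iff hv h (hΛ hm) hl).2 hml.2
  rw [hv0] at this
  exact (le_max_left B M).trans this.le

/-- Off the origin, solutions tend to zero as the parameter tends to infinity: above any fixed
relative height the partial time maps are bounded, uniformly in the amplitude. -/
lemma tendsto_apply_zero_of_ne (h : Admissible p q γ f)
    (hU : ∀ lam ∈ Ioi 0, IsPositiveSolution p f lam (U lam)) {x : ℝ}
    (hx : x ∈ Icc (-1 : ℝ) 1) (hx0 : x ≠ 0) : Tendsto (fun lam => U lam x) atTop (𝓝 0) := by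
  have hp1 : 0 < p - 1 := by linarith [h.one_lt]
  have hp0 : 0 < p := by linarith
  obtain ⟨θ, hγθ, hFθ, hθ⟩ := h.exists_theta
  have hθ0 := h.pos_gamma.trans hγθ
  have hu₁ := hU 1 (one_pos : (0 : ℝ) < 1)
  have hA₁ := hu₁.apply_zero_mem h one_pos
  refine tendsto_order.2 ⟨fun a ha => ?_, fun ε hε => ?_⟩
  · filter_upwards [eventually_gt_atTop 0] with m hm
    exact ha.trans_le ((hU m hm).nonneg hx)
  · set e := ε / U 1 0 with he
    have he0 : 0 < e := div_pos hε hA₁.1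
    have hlim : Tendsto (fun m : ℝ => (p / (p - 1) * m) ^ (1 / p) * |x|) atTop atTop :=
      ((tendsto_rpow_atTop (by positivity)).comp
        (tendsto_id.const_mul_atTop (by positivity))).atTop_mul_const (abs_pos.2 hx0)
    filter_upwards [eventually_gt_atTop 1, hlim.eventually (eventually_gt_atTop (tail p f θ e))]
      with m hm1 hm
    have hm0 : 0 < m := one_pos.trans hm1
    have hu := hU m hm0
    have hA := hu.apply_zero_mem h hm0
    have hlt := (hu₁.apply_zero_lt_iff hu h one_pos hm0).2 hm1
    by_contra! hge
    have ht := hu.div_mem h hm0 hx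
    have het : e ≤ U m x / U m 0 := by
      rw [he]
      exact div_le_div₀ (hu.nonneg hx) hge hA.1 hlt.le
    have h1 : tail p f (U m 0) (U m x / U m 0) ≤ tail p f (U m 0) e :=
      (h.strictAntiOn_tail hA).antitoneOn ⟨he0.le, het.trans ht.2⟩ ht het
    have hsub : Ioo e 1 ⊆ Ioo 0 1 := Ioo_subset_Ioo_left he0.le
    have h2 : tail p f (U m 0) e ≤ tail p f θ e :=
      setIntegral_mono_on (hA.2.2.mono_set hsub) (h.integrableOn_ker_right hθ0 hFθ.ge he0)
        measurableSet_Ioo fun t ht => h.ker_le hθ0 hFθ.ge ((hθ _ hA.1).1 hA.2.1) (hsub ht)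
    rw [hu.tail_eq h hm0 hx] at h1
    linarith

end Curve

end PLap

theorem theorem3p1 (p q γ : ℝ) (f : ℝ → ℝ) (hp : 1 < p) (hγ : 0 < γ)
    (hf : ContDiffOn ℝ 1 f (Ici 0))
    (hneg : ∀ u ∈ Ioo 0 γ, f u < 0) (hpos : ∀ u, γ < u → 0 < f u)
    (hincr : ∀ u, γ < u → 0 < deriv f u - (p - 1) * (f u / u))
    (hq : p - 1 < q)
    (hgrowth : ∃ L : EReal, 0 < L ∧
      Tendsto (fun u : ℝ => ((f u / u ^ q : ℝ) : EReal)) atTop (𝓝 L))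
    (hHopf : f 0 = 0 → ∃ c₀ > 0, ∀ᶠ s in 𝓝[>] (0 : ℝ), -f s < c₀ * s ^ (p - 1)) :
    -- at most one positive solution for each value of the parameter
    (∀ lam, 0 < lam → ∀ u₁ u₂, PLap.IsPositiveSolution p f lam u₁ →
      PLap.IsPositiveSolution p f lam u₂ → EqOn u₁ u₂ (Icc (-1) 1)) ∧
    -- existence for small values of the parameter
    (∃ ε > 0, ∀ lam ∈ Ioo 0 ε, ∃ u, PLap.IsPositiveSolution p f lam u) ∧
    -- non-degeneracy
    (∀ lam, 0 < lam → ∀ u, PLap.IsPositiveSolution p f lam u →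
      PLap.NondegenerateEven p f lam u ∧
      (PLap.D u 1 ≠ 0 → PLap.Nondegenerate p f lam u)) ∧
    -- the solution curve if `f 0 < 0`
    (f 0 < 0 → ∃ lam₀ > 0, ∃ U : ℝ → ℝ → ℝ,
      PLap.IsSolutionCurve p f (Ioc 0 lam₀) U ∧
      (∀ lam ∈ Ioo 0 lam₀, PLap.Nondegenerate p f lam (U lam)) ∧
      Tendsto (fun lam => U lam 0) (𝓝[>] 0) atTop ∧
      PLap.D (U lam₀) (-1) = 0 ∧ PLap.D (U lam₀) 1 = 0) ∧
    -- the solution curve if `f 0 = 0`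
    (f 0 = 0 → ∃ U : ℝ → ℝ → ℝ,
      PLap.IsSolutionCurve p f (Ioi 0) U ∧
      (∀ lam, 0 < lam → PLap.Nondegenerate p f lam (U lam)) ∧
      Tendsto (fun lam => U lam 0) (𝓝[>] 0) atTop ∧
      ∀ x ∈ Icc (-1 : ℝ) 1, x ≠ 0 → Tendsto (fun lam => U lam x) atTop (𝓝 0)) := by
  have h : PLap.Admissible p q γ f := by
    refine ⟨hp, hγ, hf, hneg, hpos, hincr, hq, ?_⟩
    obtain ⟨L, hL, hlim⟩ := hgrowth
    obtain ⟨c, hc0, hcL⟩ := EReal.lt_iff_exists_real_btwn.1 hL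
    have hev := (hlim.eventually (lt_mem_nhds hcL)).and (eventually_gt_atTop 0)
    obtain ⟨S, hS⟩ := eventually_atTop.1 hev
    refine ⟨c, EReal.coe_pos.1 hc0, S, (hS S le_rfl).2, fun s hs => ?_⟩
    obtain ⟨h1, h2⟩ := hS s hs
    have h3 : c < f s / s ^ q := EReal.coe_lt_coe_iff.1 h1
    exact ((lt_div_iff₀ (Real.rpow_pos_of_pos h2 q)).1 h3).le
  obtain ⟨θ, hγθ, hFθ, hθ⟩ := h.exists_theta
  have hθ0 : 0 < θ := hγ.trans hγθ
  have hFpos : ∀ M, θ < M → 0 < PLap.prim f M := fun M hM => by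
    rw [← hFθ]
    exact h.strictMonoOn_prim hγθ.le (hγθ.trans hM).le hM
  have hθle : ∀ M ∈ PLap.amplitudes p f, θ ≤ M := fun M hM => (hθ M hM.1).1 hM.2.1
  refine ⟨fun lam hlam u₁ u₂ h₁ h₂ => h₁.eqOn h₂ h hlam, ?_,
    fun lam hlam u hu => ⟨hu.nondegenerateEven h hlam, hu.nondegenerate h hlam⟩, fun h0 => ?_,
    fun h0 => ?_⟩
  · obtain ⟨M, hM⟩ := h.exists_mem_amplitudes
    obtain ⟨ε, hε, u, hu, -⟩ := h.exists_solution_of_mem hM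
    exact ⟨ε, hε, fun lam hlam => hu.exists_of_le h hlam.1 hlam.2.le⟩
  · obtain ⟨lam₀, hlam₀, v, hv, hv0⟩ :=
      h.exists_solution_of_mem (h.mem_amplitudes_of_zero_neg h0 hθ0 hFθ)
    have hex : ∀ lam, ∃ u, lam ∈ Ioc 0 lam₀ → PLap.IsPositiveSolution p f lam u := fun lam => by
      by_cases hlam : lam ∈ Ioc 0 lam₀
      · obtain ⟨u, hu⟩ := hv.exists_of_le h hlam.1 hlam.2
        exact ⟨u, fun _ => hu⟩
      · exact ⟨0, fun h1 => absurd h1 hlam⟩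
    choose U hU using hex
    have hΛ : Ioc 0 lam₀ ⊆ Ioi 0 := fun lam hlam => hlam.1
    refine ⟨lam₀, hlam₀, U, PLap.isSolutionCurve h hΛ hU fun lam hlam u hu => ⟨hlam, ?_⟩, ?_,
      PLap.tendsto_apply_zero_atTop h hΛ hU (Ioc_mem_nhdsGT hlam₀), ?_⟩
    · by_contra! hlt
      have h1 := (hv.apply_zero_lt_iff hu h hlam₀ hlam).2 hlt
      rw [hv0] at h1
      exact (hθle _ (hu.apply_zero_mem h hlam)).not_gt h1
    · intro lam hlam
      have hu := hU lam (Ioo_subset_Ioc_self hlam)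
      have h1 := (hu.apply_zero_lt_iff hv h hlam.1 hlam₀).2 hlam.2
      rw [hv0] at h1
      exact hu.nondegenerate h hlam.1 (hu.D_one_ne_zero h hlam.1 (hFpos _ h1))
    · have hu := hU lam₀ ⟨hlam₀, le_rfl⟩
      have hu0 : U lam₀ 0 = θ := by
        rw [← hv0]
        exact hu.eqOn hv h hlam₀ ⟨by norm_num, by norm_num⟩
      have h1 : PLap.D (U lam₀) 1 = 0 := by
        rw [hu.D_of_mem_Icc h hlam₀ ⟨zero_le_one, le_rfl⟩, hu.right, hu0, PLap.speed, hFθ,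
          PLap.prim_zero, sub_zero, mul_zero, Real.zero_rpow (by positivity), neg_zero]
      refine ⟨?_, h1⟩
      rw [hu.D_neg h hlam₀ ⟨by norm_num, le_rfl⟩, h1, neg_zero]
  · have hθA : θ ∉ PLap.amplitudes p f := h.notMem_amplitudes (hHopf h0) hFθ
    have hlt : ∀ M ∈ PLap.amplitudes p f, θ < M := fun M hM =>
      lt_of_le_of_ne (hθle M hM) fun heq => hθA (heq ▸ hM)
    have hex : ∀ lam, ∃ u, lam ∈ Ioi 0 → PLap.IsPositiveSolution p f lam u := fun lam => by
      by_cases hlam : 0 < lam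
      · have hs : 0 < (p / (p - 1) * lam) ^ (1 / p) := by
          have : 0 < p - 1 := by linarith
          exact Real.rpow_pos_of_pos (by positivity) _
        obtain ⟨M₁, hM₁, hle⟩ := h.exists_lt_timeMap hθ0 hFθ hθA
          (fun M hM => h.mem_amplitudes_of_prim_pos (hθ0.trans hM) (hFpos M hM))
          ((p / (p - 1) * lam) ^ (1 / p))
        obtain ⟨M, hM, hT⟩ := h.exists_timeMap_eq hM₁ hs hle.le
        obtain ⟨u, hu, -⟩ := h.exists_solution hlam hM hT
        exact ⟨u, fun _ => hu⟩
      · exact ⟨0, fun h1 => absurd h1 hlam⟩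
    choose U hU using hex
    refine ⟨U, PLap.isSolutionCurve h Subset.rfl hU fun lam hlam _ _ => hlam, fun lam hlam => ?_,
      PLap.tendsto_apply_zero_atTop h Subset.rfl hU self_mem_nhdsWithin,
      fun x hx hx0 => PLap.tendsto_apply_zero_of_ne h hU hx hx0⟩
    have hu := hU lam hlam
    exact hu.nondegenerate h hlam
      (hu.D_one_ne_zero h hlam (hFpos _ (hlt _ (hu.apply_zero_mem h hlam))))
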